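/- Let $n\ge 2$ and let $F_n$ be the group of all piecewise linear orientation preserving homeomorphisms of $[0,1]$ whose slopes are powers of $n$ and whose breakpoints lie in $\mathbb{Z}[1/n]$; it acts on $[0,1]$ from the right ($x.gh=(x.g).h$, $g^h=h^{-1}gh$), and $F_n'$ is its derived subgroup. Put $\chi(g)=\log_n g'(0)$ and $\chi_1(g)=\log_n g'(1)$. *Hyperbolic structures.* A generating set $A$ of $F_n$ is dominated by a generating set $B$ if the elements of $B$ have bounded word length with respect to $A$. A hyperbolic structure is a class $[A]$, up to mutual domination, of generating sets for which the Cayley graph $\mathrm{Cay}(F_n,A)$ is Gromov hyperbolic; structures are ordered by domination. Let $\mathcal X$ be the poset of those hyperbolic structures $[A]$ for which the action of $F_n$ on $\mathrm{Cay}(F_n,A)$ is quasi-parabolic (infinite limit set, and a fixed point $\xi$ in the Gromov boundary) and has as Busemann pseudocharacter a positive multiple of $\chi$; here the Busemann pseudocharacter is the homogenization of $g\mapsto\limsup_i\,(d(x,x_i)-d(gx,x_i))$, for $x_i\to\xi$. *Confining subsets.* Choose $a_0,\dots,a_{n-1}\in F_n$, each $a_i$ having as support an open interval $(\ell_i,r_i)$,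 with $\ell_0=0$, $r_{i-1}<\ell_i$, $r_{n-1}=1$, $\chi(a_0)=1$, $\chi_1(a_{n-1})=1$, and such that the $a_i$ generate the abelianization of $F_n$. Write $a=a_0$, $r=r_0$, $Z=\langle a_0,\dots,a_{n-1}\rangle\cong\mathbb{Z}^n$, so that $F_n=F_n'\rtimes Z$, and $Z_\chi=\{z\in Z : |\chi(z)|\le 1\}$. A subset $Q=Q^{-1}\subseteq F_n'$ is ($\chi$-)confining if $Q^z\subseteq Q$ for all $z\in Z$ with $\chi(z)\ge0$, for each $h\in F_n'$ there is $z\in Z$ with $h^z\in Q$, and $(Q\cdot Q)^{z_0}\subseteq Q$ for some $z_0\in Z$; it is strictly confining if moreover $Q^z\subsetneq Q$ for some $z\in Z$. Write $Q_1\preceq Q_2$ if $Q_2$ is bounded in the word length of $Q_1\cup Z_\chi$, and call $Q_1,Q_2$ equivalent if $Q_1\preceq Q_2\preceq Q_1$. A confining subset is lamplike if it is equivalent to a confining subset all of whose elements fix a common point $t\in(0,r)$. A hyperbolic structure is lamplike if it equals $[Q\cup Z_\chi]$ for a lamplike confining subset $Q$. *The sets $Q_S$.* Let $r=\tau_0>\tau_1>\tau_2>\cdots>0$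 be a sequence with $\tau_j.a^{-1}=\tau_{2j}$ for all $j\ge1$. For a set $S$ of odd natural numbers let $\widetilde S$ be the smallest subset of $\mathbb{N}$ containing $S$ such that $s\in\widetilde S$ implies $2s,\,2^5s+1,\,2^5s-1\in\widetilde S$, and put $$Q_S=\{g\in F_n' : \tau_s.g,\ \tau_s.g^{-1}\in(\tau_{s+1},\tau_{s-1})\text{ for all }s\in\widetilde S\}.$$ Call a set $O$ of odd natural numbers sparse if for all $x,y\in O$ and $p\in\mathbb{Z}$, $|x-2^py|\le2^{p-3}$ implies $p=0$ and $x=y$. **Theorem.** There is an order embedding of $\mathcal P(\mathbb{N})$ (ordered by inclusion) into $\mathcal X$ whose image consists of non-lamplike structures, whatever the choice of the $a_i$. More precisely, infinite sparse sets exist, and for every choice of the $a_i$ as above, sequences $\tau$ as above exist, and for each of them: 1. for every non-empty set $S$ of odd natural numbers, $Q_S$ is a strictly confining subset that is not lamplike, and $[Q_S\cup Z_\chi]$ is a non-lamplike element of $\mathcal X$; 2. for every sparse set $O$ and all $S,R\subseteq O$: $Q_S\preceq Q_R$ if and only if $S\subseteq R$; 3. for every infinite sparse set $O$ there is an order embedding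 $\mathcal P(\mathbb{N})\to\mathcal X$ whose image consists of non-lamplike structures of the form $[Q_S\cup Z_\chi]$ with $\emptyset\ne S\subseteq O$. -/

import Mathlib

open Set Filter Topology

noncomputable section

namespace ThompsonHyp

section Hyperbolic

variable {X : Type*} [PseudoMetricSpace X]

/-- The Gromov product `(x|y)_o`. -/
def gromovProduct (o x y : X) : ℝ := (dist x o + dist y o - dist x y) / 2

variable (X) in
/-- Gromov hyperbolicity, by the four-point condition. -/
def IsGromovHyperbolic : Prop :=
  ∃ δ : ℝ, ∀ o x y z : X,
    min (gromovProduct o x y) (gromovProduct o y z) - δ ≤ gromovProduct o x z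

/-- `(x_i|y_j)_o → ∞` as `i, j → ∞` (for every, equivalently some, base point `o`). -/
def SeqAsymptotic (x y : ℕ → X) : Prop :=
  ∀ o : X, Tendsto (fun p : ℕ × ℕ => gromovProduct o (x p.1) (y p.2)) atTop atTop

variable (X) in
/-- Sequences converging to infinity. -/
def SeqToInfinity : Type _ := {x : ℕ → X // SeqAsymptotic x x}

variable (X) in
/-- The Gromov boundary `∂X`: sequences converging to infinity, two of them being identified if
they are asymptotic to each other (an equivalence relation when `X` is hyperbolic). -/
def GromovBoundary : Type _ :=
  Quot (fun x y : SeqToInfinity X => SeqAsymptotic x.1 y.1)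

variable {G : Type*} [Group G] [MulAction G X] [IsIsometricSMul G X]

theorem SeqAsymptotic.smul {x y : ℕ → X} (h : SeqAsymptotic x y) (g : G) :
    SeqAsymptotic (fun i => g • x i) (fun i => g • y i) := by
  intro o
  refine (h (g⁻¹ • o)).congr fun p => ?_
  have key : ∀ w : X, dist (g • w) o = dist w (g⁻¹ • o) := fun w => by
    rw [← dist_smul g w (g⁻¹ • o), smul_inv_smul]
  simp only [gromovProduct, key, dist_smul]

/-- The action of an isometry group on the Gromov boundary. -/
def boundaryMap (g : G) : GromovBoundary X → GromovBoundary X :=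
  Quot.map (fun x : SeqToInfinity X => ⟨fun i => g • x.1 i, x.2.smul g⟩)
    (fun _ _ h => SeqAsymptotic.smul h g)

variable (G X) in
/-- The limit set `Λ(G)`: limits in `∂X` of sequences in a `G`-orbit. -/
def limitSet : Set (GromovBoundary X) :=
  {ξ | ∃ x : SeqToInfinity X,
    (∃ o : X, ∀ i, x.1 i ∈ MulAction.orbit G o) ∧ Quot.mk _ x = ξ}

/-- The function `p` is the Busemann pseudocharacter at the boundary point `ξ`, that is, the
homogenization of `g ↦ limsup_i (d(o, x_i) - d(g o, x_i))` for a sequence `x_i → ξ` and a point `o`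
(the homogenization does not depend on these choices). -/
def IsBusemann (ξ : GromovBoundary X) (p : G → ℝ) : Prop :=
  ∃ x : SeqToInfinity X, Quot.mk _ x = ξ ∧ ∃ o : X, ∀ g : G,
    Tendsto (fun k : ℕ =>
      limsup (fun i => dist o (x.1 i) - dist (g ^ k • o) (x.1 i)) atTop / (k : ℝ))
      atTop (𝓝 (p g))

variable (X) in
/-- The action is quasi-parabolic (non-elementary, with a fixed point in the boundary), and its
Busemann pseudocharacter is a positive multiple of `ρ`. -/
def IsQuasiParabolicWith (ρ : G → ℝ) : Prop :=
  (limitSet X G).Infinite ∧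
    ∃ ξ : GromovBoundary X, (∀ g : G, boundaryMap g ξ = ξ) ∧
      ∃ c : ℝ, 0 < c ∧ IsBusemann ξ (fun g : G => c * ρ g)

end Hyperbolic

section Words

variable {G : Type*} [Group G]

/-- `l` is a word in the alphabet `A ∪ A⁻¹`. -/
def IsWord (A : Set G) (l : List G) : Prop := ∀ x ∈ l, x ∈ A ∨ x⁻¹ ∈ A

/-- `B` is bounded in the alphabet `A`. -/
def BoundedIn (A B : Set G) : Prop :=
  ∃ K : ℕ, ∀ b ∈ B, ∃ l : List G, IsWord A l ∧ l.length ≤ K ∧ l.prod = b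

theorem IsWord.append {A : Set G} {l m : List G} (hl : IsWord A l) (hm : IsWord A m) :
    IsWord A (l ++ m) := by
  intro x hx
  rcases List.mem_append.1 hx with h | h
  exacts [hl x h, hm x h]

theorem IsWord.inv {A : Set G} {l : List G} (hl : IsWord A l) :
    IsWord A (l.map (·⁻¹)).reverse := by
  intro x hx
  simp only [List.mem_reverse, List.mem_map] at hx
  obtain ⟨y, hy, rfl⟩ := hx
  rw [inv_inv]
  exact (hl y hy).symm

theorem BoundedIn.refl (A : Set G) : BoundedIn A A :=
  ⟨1, fun b hb => ⟨[b], by simp [IsWord, hb], by simp, by simp⟩⟩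

theorem BoundedIn.trans {A B C : Set G} (h₁ : BoundedIn A B) (h₂ : BoundedIn B C) :
    BoundedIn A C := by
  obtain ⟨K, hK⟩ := h₁
  obtain ⟨L, hL⟩ := h₂
  have step : ∀ l : List G, IsWord B l →
      ∃ m : List G, IsWord A m ∧ m.length ≤ K * l.length ∧ m.prod = l.prod := by
    intro l
    induction l with
    | nil => exact fun _ => ⟨[], by simp [IsWord], by simp, rfl⟩
    | cons x l ih =>
      intro hl
      obtain ⟨m, hm, hlen, hprod⟩ := ih fun y hy => hl y (List.mem_cons_of_mem _ hy)
      obtain ⟨w, hw, hwlen, hwprod⟩ :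
          ∃ w : List G, IsWord A w ∧ w.length ≤ K ∧ w.prod = x := by
        rcases hl x List.mem_cons_self with h | h
        · exact hK x h
        · obtain ⟨w, hw, h1, h2⟩ := hK _ h
          refine ⟨(w.map (·⁻¹)).reverse, hw.inv, by simpa using h1, ?_⟩
          rw [← List.prod_inv_reverse, h2, inv_inv]
      refine ⟨w ++ m, hw.append hm, ?_, by simp [hprod, hwprod]⟩
      simp only [List.length_append, List.length_cons, Nat.mul_add, Nat.mul_one]
      omega
  refine ⟨K * L, fun c hc => ?_⟩
  obtain ⟨l, hl, hlen, hprod⟩ := hL c hc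
  obtain ⟨m, hm, hmlen, hmprod⟩ := step l hl
  exact ⟨m, hm, hmlen.trans (Nat.mul_le_mul_left _ hlen), hmprod.trans hprod⟩

/-- Word length with respect to `A` (meaningful when `A` generates). -/
def wordLength (A : Set G) (g : G) : ℕ :=
  sInf {k | ∃ l : List G, IsWord A l ∧ l.length = k ∧ l.prod = g}

variable (G) in
/-- Generating sets of a group. -/
structure GenSet where
  carrier : Set G
  generates : Subgroup.closure carrier = ⊤

theorem GenSet.exists_word (A : GenSet G) (g : G) :
    ∃ l : List G, IsWord A.carrier l ∧ l.length = wordLength A.carrier g ∧ l.prod = g := by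
  have h : g ∈ Subgroup.closure A.carrier := A.generates ▸ Subgroup.mem_top g
  rw [← Subgroup.mem_toSubmonoid, Subgroup.closure_toSubmonoid] at h
  obtain ⟨l, hl, hp⟩ := Submonoid.exists_list_of_mem_closure h
  replace hl : IsWord A.carrier l := hl
  exact Nat.sInf_mem (s := {k | ∃ l : List G, IsWord A.carrier l ∧ l.length = k ∧ l.prod = g})
    ⟨l.length, l, hl, rfl, hp⟩

theorem wordLength_le {A : Set G} {l : List G} (hl : IsWord A l) :
    wordLength A l.prod ≤ l.length :=
  Nat.sInf_le ⟨l, hl, rfl, rfl⟩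

theorem wordLength_one (A : Set G) : wordLength A (1 : G) = 0 :=
  Nat.le_zero.1 (wordLength_le (l := []) (by simp [IsWord]))

theorem GenSet.wordLength_mul_le (A : GenSet G) (g h : G) :
    wordLength A.carrier (g * h) ≤ wordLength A.carrier g + wordLength A.carrier h := by
  obtain ⟨l, hl, h1, h2⟩ := A.exists_word g
  obtain ⟨m, hm, h3, h4⟩ := A.exists_word h
  have := wordLength_le (hl.append hm)
  rwa [List.prod_append, h2, h4, List.length_append, h1, h3] at this

theorem GenSet.wordLength_inv_le (A : GenSet G) (g : G) :
    wordLength A.carrier g⁻¹ ≤ wordLength A.carrier g := by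
  obtain ⟨l, hl, h1, h2⟩ := A.exists_word g
  have := wordLength_le hl.inv
  rwa [← List.prod_inv_reverse, h2, List.length_reverse, List.length_map, h1] at this

/-- The vertex set of the Cayley graph `Cay(G, A)`, with the path metric of the graph, that is, the
word metric `d(g, h) = |g⁻¹ h|_A`. (Every point of the graph is at distance at most `1/2` from a
vertex, so hyperbolicity, the boundary, limit sets and Busemann pseudocharacters can be computed
on the vertices.) -/
def Cay (_A : GenSet G) : Type _ := G

instance (A : GenSet G) : PseudoMetricSpace (Cay A) where
  dist := fun g h : G => (wordLength A.carrier (g⁻¹ * h) : ℝ)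
  dist_self := fun g : G => by
    rw [inv_mul_cancel, wordLength_one, Nat.cast_zero]
  dist_comm := fun g h : G => by
    have key : ∀ u v : G, wordLength A.carrier (u⁻¹ * v) ≤ wordLength A.carrier (v⁻¹ * u) := by
      intro u v
      simpa using A.wordLength_inv_le (v⁻¹ * u)
    exact congrArg _ (le_antisymm (key g h) (key h g))
  dist_triangle := fun g h k : G => by
    have := A.wordLength_mul_le (g⁻¹ * h) (h⁻¹ * k)
    rw [mul_assoc, mul_inv_cancel_left] at this
    exact_mod_cast this

instance (A : GenSet G) : MulAction G (Cay A) :=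
  inferInstanceAs (MulAction G G)

instance (A : GenSet G) : IsIsometricSMul G (Cay A) where
  isometry_smul := fun c => Isometry.of_dist_eq <| by
    have key : ∀ g h : G, (wordLength A.carrier ((c * g)⁻¹ * (c * h)) : ℝ) =
        (wordLength A.carrier (g⁻¹ * h) : ℝ) := fun g h => by
      rw [mul_inv_rev, mul_assoc, inv_mul_cancel_left]
    exact key

variable (G) in
/-- Generating sets with hyperbolic Cayley graph. -/
def HypGenSet : Type _ := {A : GenSet G // IsGromovHyperbolic (Cay A)}

/-- `A` is dominated by `B` if `B` is bounded in the word length of `A`. -/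
instance : Preorder (HypGenSet G) where
  le A B := BoundedIn A.1.carrier B.1.carrier
  le_refl A := BoundedIn.refl _
  le_trans _ _ _ h₁ h₂ := h₁.trans h₂

variable (G) in
/-- The poset of hyperbolic structures on `G`: generating sets with hyperbolic Cayley graph, up to
mutual domination, ordered by domination. -/
def Hyp : Type _ := Antisymmetrization (HypGenSet G) (· ≤ ·)

instance : PartialOrder (Hyp G) :=
  inferInstanceAs (PartialOrder (Antisymmetrization (HypGenSet G) (· ≤ ·)))

/-- The hyperbolic structure `s` is the class of the set `A`. -/
def Hyp.IsClassOf (s : Hyp G) (A : Set G) : Prop :=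
  ∃ B : HypGenSet G, B.1.carrier = A ∧ toAntisymmetrization (· ≤ ·) B = s

/-- The quasi-parabolic hyperbolic structures whose Busemann pseudocharacter is equivalent
to `ρ`. -/
def HypQP (ρ : G → ℝ) : Set (Hyp G) :=
  {s | ∃ A : HypGenSet G, toAntisymmetrization (· ≤ ·) A = s ∧ IsQuasiParabolicWith (Cay A.1) ρ}

/-- Confining subsets of `H` with respect to `ρ`, where `H` is normalized by the abelian group `Z`
and `ρ` restricts to a character of `Z`. -/
structure IsConfining (H Z : Subgroup G) (ρ : G → ℝ) (Q : Set G) : Prop where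
  subset : Q ⊆ H
  symmetric : ∀ q ∈ Q, q⁻¹ ∈ Q
  stay : ∀ z ∈ Z, 0 ≤ ρ z → ∀ q ∈ Q, z⁻¹ * q * z ∈ Q
  get : ∀ h ∈ H, ∃ z ∈ Z, z⁻¹ * h * z ∈ Q
  prod : ∃ z ∈ Z, ∀ p ∈ Q, ∀ q ∈ Q, z⁻¹ * (p * q) * z ∈ Q

structure IsStrictlyConfining (H Z : Subgroup G) (ρ : G → ℝ) (Q : Set G) : Prop
    extends IsConfining H Z ρ Q where
  strict : ∃ z ∈ Z, (fun q => z⁻¹ * q * z) '' Q ⊂ Q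

end Words

section Thompson

local notation "I" => unitInterval

/-- Elements of `ℤ[1/n]`. -/
def IsNAdic (n : ℕ) (x : ℝ) : Prop := ∃ (m : ℤ) (k : ℕ), x = m / (n : ℝ) ^ k

/-- The order automorphism `g` of `[0, 1]` (the same as an orientation preserving homeomorphism) is
piecewise linear, with slopes powers of `n` and breakpoints in `ℤ[1/n]`: there is a finite set `B`
of points of `ℤ[1/n]` such that `g` is affine, with slope a power of `n`, on every closed interval
without points of `B` in its interior. -/
def IsPL (n : ℕ) (g : I ≃o I) : Prop :=
  ∃ B : Finset I, (∀ b ∈ B, IsNAdic n b) ∧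
    ∀ x y : I, x < y → (∀ b ∈ B, ¬ (x < b ∧ b < y)) →
      ∃ k : ℤ, ∀ z : I, x ≤ z → z ≤ y → (g z : ℝ) = g x + (n : ℝ) ^ k * ((z : ℝ) - x)

variable {n : ℕ}

theorem IsNAdic.add [n.AtLeastTwo] {x y : ℝ} (hx : IsNAdic n x) (hy : IsNAdic n y) :
    IsNAdic n (x + y) := by
  obtain ⟨m, k, rfl⟩ := hx
  obtain ⟨m', k', rfl⟩ := hy
  have hn : (n : ℝ) ≠ 0 := Nat.cast_ne_zero.2 (NeZero.ne n)
  refine ⟨m * n ^ k' + m' * n ^ k, k + k', ?_⟩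
  push_cast
  field_simp
  ring

theorem IsNAdic.neg {x : ℝ} (hx : IsNAdic n x) : IsNAdic n (-x) := by
  obtain ⟨m, k, rfl⟩ := hx
  exact ⟨-m, k, by push_cast; ring⟩

theorem IsNAdic.zpow_mul [n.AtLeastTwo] {x : ℝ} (hx : IsNAdic n x) (j : ℤ) :
    IsNAdic n ((n : ℝ) ^ j * x) := by
  obtain ⟨m, k, rfl⟩ := hx
  have hn : (n : ℝ) ≠ 0 := Nat.cast_ne_zero.2 (NeZero.ne n)
  obtain ⟨i, rfl | rfl⟩ := j.eq_nat_or_neg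
  · refine ⟨m * n ^ i, k, ?_⟩
    push_cast
    rw [zpow_natCast]
    ring
  · refine ⟨m, k + i, ?_⟩
    rw [zpow_neg, zpow_natCast, pow_add]
    field_simp

theorem IsPL.map_nAdic [n.AtLeastTwo] {g : I ≃o I} (hg : IsPL n g) {x : I}
    (hx : IsNAdic n x) : IsNAdic n (g x) := by
  classical
  obtain ⟨B, hB, haff⟩ := hg
  have main : ∀ (N : ℕ) (x : I), (B.filter (· < x)).card = N → IsNAdic n x →
      IsNAdic n (g x) := by
    intro N
    induction N using Nat.strong_induction_on with
    | _ N ih =>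
      intro x hN hx
      have step : ∀ b : I, b < x → IsNAdic n b → IsNAdic n (g b) →
          (∀ c ∈ B, ¬ (b < c ∧ c < x)) → IsNAdic n (g x) := by
        intro b hbx hb hgb hc
        obtain ⟨k, hk⟩ := haff b x hbx hc
        rw [hk x hbx.le le_rfl, sub_eq_add_neg]
        exact hgb.add ((hx.add hb.neg).zpow_mul k)
      have h0 : IsNAdic n ((0 : I) : ℝ) := ⟨0, 0, by simp⟩
      have hg0 : g 0 = 0 := g.map_bot
      by_cases hne : (B.filter (· < x)).Nonempty
      · have hmem := Finset.max'_mem _ hne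
        set b := (B.filter (· < x)).max' hne with hbdef
        obtain ⟨hbB, hbx⟩ := Finset.mem_filter.1 hmem
        refine step b hbx (hB b hbB) (ih _ ?_ b rfl (hB b hbB)) ?_
        · rw [← hN]
          refine Finset.card_lt_card ((Finset.ssubset_iff_of_subset ?_).2 ⟨b, hmem, ?_⟩)
          · intro c hc
            rw [Finset.mem_filter] at hc ⊢
            exact ⟨hc.1, hc.2.trans hbx⟩
          · simp
        · rintro c hcB ⟨h1, h2⟩
          exact absurd (Finset.le_max' _ c (Finset.mem_filter.2 ⟨hcB, h2⟩)) (not_le.2 h1)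
      · rcases eq_or_lt_of_le (bot_le : (⊥ : I) ≤ x) with h | h
        · rw [← h]
          have : g (⊥ : I) = ⊥ := g.map_bot
          rw [this]
          exact h0
        · refine step 0 h h0 (by rw [hg0]; exact h0) ?_
          rintro c hcB ⟨_, h2⟩
          exact hne ⟨c, Finset.mem_filter.2 ⟨hcB, h2⟩⟩
  exact main _ x rfl hx

theorem IsPL.symm [n.AtLeastTwo] {g : I ≃o I} (hg : IsPL n g) : IsPL n g.symm := by
  classical
  have hn : (n : ℝ) ≠ 0 := Nat.cast_ne_zero.2 (NeZero.ne n)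
  have hmap := @IsPL.map_nAdic n _ g hg
  obtain ⟨B, hB, haff⟩ := hg
  refine ⟨B.image g, ?_, ?_⟩
  · intro b hb
    obtain ⟨c, hc, rfl⟩ := Finset.mem_image.1 hb
    exact hmap (hB c hc)
  · intro x y hxy h
    obtain ⟨k, hk⟩ := haff (g.symm x) (g.symm y) (g.symm.strictMono hxy) (by
      rintro b hb ⟨h1, h2⟩
      exact h (g b) (Finset.mem_image_of_mem _ hb)
        ⟨g.symm_apply_lt.1 h1, g.lt_symm_apply.1 h2⟩)
    refine ⟨-k, fun z hxz hzy => ?_⟩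
    have := hk (g.symm z) (g.symm.monotone hxz) (g.symm.monotone hzy)
    rw [g.apply_symm_apply, g.apply_symm_apply] at this
    rw [this, zpow_neg]
    have hk0 : (n : ℝ) ^ k ≠ 0 := zpow_ne_zero _ hn
    field_simp
    ring

theorem IsPL.trans [n.AtLeastTwo] {f g : I ≃o I} (hf : IsPL n f) (hg : IsPL n g) :
    IsPL n (f.trans g) := by
  classical
  have hn : (n : ℝ) ≠ 0 := Nat.cast_ne_zero.2 (NeZero.ne n)
  have hmap := @IsPL.map_nAdic n _ f.symm hf.symm
  obtain ⟨B, hB, hfaff⟩ := hf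
  obtain ⟨C, hC, hgaff⟩ := hg
  refine ⟨B ∪ C.image f.symm, ?_, ?_⟩
  · intro b hb
    rcases Finset.mem_union.1 hb with h | h
    · exact hB b h
    · obtain ⟨c, hc, rfl⟩ := Finset.mem_image.1 h
      exact hmap (hC c hc)
  · intro x y hxy h
    obtain ⟨k, hk⟩ := hfaff x y hxy fun b hb => h b (Finset.mem_union_left _ hb)
    obtain ⟨j, hj⟩ := hgaff (f x) (f y) (f.strictMono hxy) (by
      rintro c hc ⟨h1, h2⟩
      exact h (f.symm c) (Finset.mem_union_right _ (Finset.mem_image_of_mem _ hc))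
        ⟨f.lt_symm_apply.2 h1, f.symm_apply_lt.2 h2⟩)
    refine ⟨j + k, fun z hxz hzy => ?_⟩
    have h1 := hj (f z) (f.monotone hxz) (f.monotone hzy)
    have h2 := hk z hxz hzy
    simp only [OrderIso.trans_apply]
    rw [h1, h2, zpow_add₀ hn]
    ring

theorem IsPL.refl (n : ℕ) : IsPL n (OrderIso.refl I) :=
  ⟨∅, by simp, fun x y _ _ => ⟨0, fun z _ _ => by simp⟩⟩

/-- The Brown--Higman--Thompson group `F_n`. Homeomorphisms act on `[0, 1]` from the right, so the
product `g * h` means `g` first, then `h`; this is the multiplication of the opposite group. -/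
def ThompsonF (n : ℕ) [n.AtLeastTwo] : Subgroup (I ≃o I)ᵐᵒᵖ where
  carrier := {g | IsPL n g.unop}
  one_mem' := IsPL.refl n
  mul_mem' := fun {_ _} hf hg => hf.trans hg
  inv_mem' := fun {_} hf => hf.symm

variable [n.AtLeastTwo]

/-- The image `x.g` of the point `x` under `g`. -/
def act (x : I) (g : ThompsonF n) : I := g.1.unop x

/-- The slope of `g` at `x`: at the end points `0` and `1` this is the one-sided derivative. -/
def slopeAt (g : ThompsonF n) (x : I) : ℝ :=
  derivWithin (fun y : ℝ => (act (projIcc 0 1 zero_le_one y) g : ℝ)) (Icc 0 1) x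

/-- The character `χ₀(g) = log_n g'(0)`. -/
def chi0 (g : ThompsonF n) : ℝ := Real.logb n (slopeAt g 0)

/-- The character `χ₁(g) = log_n g'(1)`. -/
def chi1 (g : ThompsonF n) : ℝ := Real.logb n (slopeAt g 1)

variable (n) in
/-- The poset `𝒳` of quasi-parabolic hyperbolic structures on `F_n` whose Busemann pseudocharacter
is equivalent to `χ₀`. -/
def PosetX : Set (Hyp (ThompsonF n)) := HypQP chi0

variable (n) in
/-- A choice of the elements `a_0, …, a_{n-1}` of `F_n` that define the splitting
`F_n = F_n' ⋊ ⟨a_0, …, a_{n-1}⟩`: one-bump functions with supports `(ℓ_i, r_i)`, ordered from left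
to right and with disjoint closures, which generate the abelianization. -/
structure Splitting where
  a : Fin n → ThompsonF n
  l : Fin n → I
  r : Fin n → I
  lt : ∀ i, l i < r i
  support : ∀ i, {x | act x (a i) ≠ x} = Ioo (l i) (r i)
  l_zero : l 0 = 0
  chi0_zero : chi0 (a 0) = 1
  r_last : ∀ i : Fin n, (i : ℕ) + 1 = n → r i = 1
  chi1_last : ∀ i : Fin n, (i : ℕ) + 1 = n → chi1 (a i) = 1
  separated : ∀ i j : Fin n, (i : ℕ) + 1 = j → r i < l j
  generates : commutator (ThompsonF n) ⊔ Subgroup.closure (range a) = ⊤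

namespace Splitting

variable (σ : Splitting n)

/-- The copy of `ℤ^n` generated by the `a_i`. -/
def Z : Subgroup (ThompsonF n) := Subgroup.closure (range σ.a)

/-- `χ`-confining subsets of `F_n'`, where `χ = χ₀`. -/
def Confining (Q : Set (ThompsonF n)) : Prop := IsConfining (commutator (ThompsonF n)) σ.Z chi0 Q

/-- Strictly `χ`-confining subsets of `F_n'`. -/
def StrictlyConfining (Q : Set (ThompsonF n)) : Prop :=
  IsStrictlyConfining (commutator (ThompsonF n)) σ.Z chi0 Q

/-- The generating set `Q ∪ Z_χ`, with `Z_χ = {z | |χ(z)| ≤ 1}`. -/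
def alphabet (Q : Set (ThompsonF n)) : Set (ThompsonF n) := Q ∪ {z | z ∈ σ.Z ∧ |chi0 z| ≤ 1}

/-- The relation `Q₁ ⪯_χ Q₂`: `Q₂` is bounded in the alphabet `Q₁ ∪ Z_χ`. -/
def ConfLE (Q₁ Q₂ : Set (ThompsonF n)) : Prop := BoundedIn (σ.alphabet Q₁) Q₂

/-- `Q` is a confining subset with global fixed point `t`. -/
def FixesPoint (Q : Set (ThompsonF n)) (t : I) : Prop :=
  σ.Confining Q ∧ ∀ q ∈ Q, act t q = t

/-- The confining subset `Q` is lamplike: it is equivalent to a confining subset with a global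
fixed point `t ∈ (0, r)`, where `(0, r)` is the support of `a = a_0`. -/
def Lamplike (Q : Set (ThompsonF n)) : Prop :=
  ∃ t ∈ Ioo 0 (σ.r 0), ∃ Q' : Set (ThompsonF n),
    σ.FixesPoint Q' t ∧ σ.ConfLE Q Q' ∧ σ.ConfLE Q' Q

/-- A hyperbolic structure is lamplike if it is the structure `[Q ∪ Z_χ]` of a lamplike confining
subset `Q`. -/
def LamplikeStructure (s : Hyp (ThompsonF n)) : Prop :=
  ∃ Q : Set (ThompsonF n), σ.Confining Q ∧ σ.Lamplike Q ∧ s.IsClassOf (σ.alphabet Q)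

/-- The special sequences `r > τ_1 > τ_2 > ⋯ > 0` with `τ_j.a⁻¹ = τ_{2j}`. The value `τ_0 = r` is a
convention; it is only used for the upper end of the interval `(τ_2, τ_0)`. -/
structure IsSpecial (τ : ℕ → I) : Prop where
  zero : τ 0 = σ.r 0
  pos : ∀ j, 0 < τ j
  anti : StrictAnti τ
  double : ∀ j, 1 ≤ j → act (τ j) (σ.a 0)⁻¹ = τ (2 * j)

end Splitting

/-- The smallest set that contains `S` and is closed under `s ↦ 2 s` and `s ↦ 2^5 s ± 1`. -/
inductive Tilde (S : Set ℕ) : ℕ → Prop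
  | base (s : ℕ) : s ∈ S → Tilde S s
  | double (s : ℕ) : Tilde S s → Tilde S (2 * s)
  | succ (s : ℕ) : Tilde S s → Tilde S (2 ^ 5 * s + 1)
  | pred (s : ℕ) : Tilde S s → Tilde S (2 ^ 5 * s - 1)

/-- The set `Q_S`. -/
def QS (τ : ℕ → I) (S : Set ℕ) : Set (ThompsonF n) :=
  {g | g ∈ commutator (ThompsonF n) ∧ ∀ s, Tilde S s →
    act (τ s) g ∈ Ioo (τ (s + 1)) (τ (s - 1)) ∧ act (τ s) g⁻¹ ∈ Ioo (τ (s + 1)) (τ (s - 1))}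

/-- Sets of odd numbers that are sparse: if `|x - 2^p y| ≤ 2^(p-3)` for elements `x, y` and an
integer `p`, then `p = 0` and `x = y`. -/
def IsSparse (O : Set ℕ) : Prop :=
  (∀ x ∈ O, Odd x) ∧ ∀ x ∈ O, ∀ y ∈ O, ∀ p : ℤ,
    |(x : ℝ) - (2 : ℝ) ^ p * y| ≤ (2 : ℝ) ^ (p - 3) → p = 0 ∧ x = y

end Thompson

end ThompsonHyp

end

open ThompsonHyp

-- Conjugation by `a` contracts ker χ into Q: a product of two elements of Q is back in Q after
-- boundedly many conjugations. Through every group element runs a vertical line, a coset of ⟨a⟩,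
-- with χ as height; two lines merge at the height where they differ by an element of Q. Up to a
-- bounded error the best way from g to h is to climb to the merging height m(g, h), cross by one
-- element of Q and descend, so d(g, h) = 2m(g, h) - χ(g) - χ(h) + O(1). The upper bound is clear.
-- For the lower bound (`path_bound`, `dist_estimate`), crossing below the merging height by R
-- letters of Q instead of one saves only O(log R) of height, because R factors are absorbed by
-- O(log R) conjugations.
--
-- Now m is almost an ultrametric, whence hyperbolicity. All upward rays converge to a single
-- boundary point, which is therefore fixed and has Busemann pseudocharacter χ. Strictness of Q
-- yields infinitely many downward rays with distinct end points. Moreover, the elements of ker χ of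
-- bounded word length are carried into Q by one power of `a` (`conj_mem_of_word`), so domination
-- amounts to inclusion up to conjugation by a power of `a`.
--
-- The sets Q_S fit into this scheme: closure of S̃ under s ↦ 2s makes them stable under conjugation
-- by `a`, closure under s ↦ 2^5 s ± 1 takes care of products, and elements of ker χ are trivial
-- near 0. If S ⊆ R, then Q_R ⊆ Q_S. If s ∈ S \ R within a sparse set, the indices just below
-- 2^(N+4) s form a long gap of R̃ (`IsSparse.tilde_gap`); an element supported there is
-- unrestricted by Q_R, and can move a point so far that its conjugate by a^N is not in Q_S
-- (`subset_of_conj_pinned`).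
--
-- If Q fixes t ∈ (0, r), all words of length at most K over Q ∪ Z_χ that lie in ker χ fix t.a^(-K)
-- (`act_word`). The elements of Q_S have no common fixed point in (0, 1) (`exists_pinned_moving`),
-- so Q_S is not lamplike.
--
-- The geometry is carried out for `pinnedKer`, the version of Q_S in ker χ, which involves only a
-- and r. Hence the embedding that must not depend on a splitting can be built from one explicit
-- `a`.

noncomputable section

open scoped commutatorElement

namespace ThompsonHyp

-- Asymptotic sequences and equality of boundary points.

section Boundary

variable {X : Type*} [PseudoMetricSpace X]

theorem gromovProduct_comm (o x y : X) : gromovProduct o x y = gromovProduct o y x := by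
  simp only [gromovProduct, dist_comm x y]; ring

theorem gromovProduct_base (o o' x y : X) :
    gromovProduct o x y - dist o o' ≤ gromovProduct o' x y := by
  have h1 := dist_triangle x o' o
  have h2 := dist_triangle y o' o
  rw [dist_comm o' o] at h1 h2
  simp only [gromovProduct]
  linarith

theorem SeqAsymptotic.of_base {x y : ℕ → X} (o : X)
    (h : Tendsto (fun p : ℕ × ℕ => gromovProduct o (x p.1) (y p.2)) atTop atTop) :
    SeqAsymptotic x y := fun o' =>
  tendsto_atTop_mono (fun p => gromovProduct_base o o' (x p.1) (y p.2))
    (tendsto_atTop_add_const_right _ (-dist o o') h)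

theorem SeqAsymptotic.symm {x y : ℕ → X} (h : SeqAsymptotic x y) : SeqAsymptotic y x := by
  intro o
  have hswap : Tendsto (Prod.swap : ℕ × ℕ → ℕ × ℕ) atTop atTop := by
    rw [← prod_atTop_atTop_eq]
    exact tendsto_snd.prodMk tendsto_fst
  refine ((h o).comp hswap).congr fun p => ?_
  simp [gromovProduct_comm]

theorem SeqAsymptotic.trans (hX : IsGromovHyperbolic X) {x y z : ℕ → X}
    (h₁ : SeqAsymptotic x y) (h₂ : SeqAsymptotic y z) : SeqAsymptotic x z := by
  obtain ⟨δ, hδ⟩ := hX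
  intro o
  rw [tendsto_atTop]
  intro b
  have e1 := (tendsto_atTop.1 (h₁ o)) (b + δ)
  have e2 := (tendsto_atTop.1 (h₂ o)) (b + δ)
  rw [eventually_atTop] at e1 e2 ⊢
  obtain ⟨⟨i, j⟩, hij⟩ := e1
  obtain ⟨⟨k, l⟩, hkl⟩ := e2
  refine ⟨(i, l), fun p hp => ?_⟩
  have a1 := hij (p.1, max j k) ⟨hp.1, le_max_left _ _⟩
  have a2 := hkl (max j k, p.2) ⟨le_max_right _ _, hp.2⟩
  have := hδ o (x p.1) (y (max j k)) (z p.2)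
  have := le_min a1 a2
  linarith

/-- Hyperbolicity makes the asymptotic relation transitive, so the quotient adds no further
identifications; this is what allows boundary points to be told apart. -/
theorem boundary_eq_iff (hX : IsGromovHyperbolic X) (x y : SeqToInfinity X) :
    (Quot.mk _ x : GromovBoundary X) = Quot.mk _ y ↔ SeqAsymptotic x.1 y.1 := by
  refine ⟨fun h => ?_, fun h => Quot.sound h⟩
  have := Quot.eqvGen_exact h
  clear h
  induction this with
  | rel _ _ h => exact h
  | refl x => exact x.2
  | symm _ _ _ ih => exact ih.symm
  | trans _ _ _ _ _ ih₁ ih₂ => exact ih₁.trans hX ih₂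

end Boundary

-- Coarse geometry of a group with a contracting subset.

section Contracting

variable {G : Type*} [Group G]

/-- `Q` is a subset of `ker χ` that is confining for the conjugation by `a`, where `χ a = 1`. -/
structure IsContracting (χ : G → ℤ) (a : G) (Q : Set G) : Prop where
  map_mul : ∀ g h, χ (g * h) = χ g + χ h
  map_a : χ a = 1
  ker : ∀ q ∈ Q, χ q = 0
  symm : ∀ q ∈ Q, q⁻¹ ∈ Q
  stay : ∀ q ∈ Q, a⁻¹ * q * a ∈ Q
  get : ∀ h, χ h = 0 → ∃ k : ℕ, (a ^ k)⁻¹ * h * a ^ k ∈ Q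
  prod : ∃ k : ℕ, ∀ p ∈ Q, ∀ q ∈ Q, (a ^ k)⁻¹ * (p * q) * a ^ k ∈ Q

/-- The letters of the alphabet `B` are, up to the elements of a subgroup `P` that commute with `a`
and that `Q` absorbs, elements of `Q` and the letters `a ^ e`, `|e| ≤ 1`. -/
structure IsAdapted (χ : G → ℤ) (a : G) (Q : Set G) (P : Subgroup G) (B : Set G) : Prop where
  comm : ∀ p ∈ P, a * p = p * a
  absorb : ∀ p ∈ P, ∀ q ∈ Q, p * q ∈ Q
  mem : a ∈ B
  bounded : BoundedIn B Q
  letters : ∀ x ∈ B, x ∈ Q ∨ (|χ x| ≤ 1 ∧ a ^ (-χ x) * x ∈ P)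

/-- The point of height `t` on the vertical line through `g`. -/
def lift (χ : G → ℤ) (a g : G) (t : ℤ) : G := g * a ^ (t - χ g)

/-- The vertical lines through `g` and `h` have merged at height `t`. -/
def Merged (χ : G → ℤ) (a : G) (Q : Set G) (g h : G) (t : ℤ) : Prop :=
  (lift χ a g t)⁻¹ * lift χ a h t ∈ Q

/-- The height at which the upward vertical rays from `g` and `h` merge. -/
def mergeHeight (χ : G → ℤ) (a : G) (Q : Set G) (g h : G) : ℤ :=
  sInf {t | χ g ≤ t ∧ χ h ≤ t ∧ Merged χ a Q g h t}

namespace IsContracting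

variable {χ : G → ℤ} {a : G} {Q : Set G}

theorem map_one (hQ : IsContracting χ a Q) : χ 1 = 0 := by
  have := hQ.map_mul 1 1
  rw [mul_one] at this
  omega

theorem map_inv (hQ : IsContracting χ a Q) (g : G) : χ g⁻¹ = -χ g := by
  have := hQ.map_mul g g⁻¹
  rw [mul_inv_cancel, hQ.map_one] at this
  omega

theorem map_pow (hQ : IsContracting χ a Q) (g : G) (k : ℕ) : χ (g ^ k) = k * χ g := by
  induction k with
  | zero => simp [hQ.map_one]
  | succ k ih => rw [pow_succ, hQ.map_mul, ih]; push_cast; ring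

theorem map_zpow (hQ : IsContracting χ a Q) (k : ℤ) : χ (a ^ k) = k := by
  obtain ⟨i, rfl | rfl⟩ := k.eq_nat_or_neg
  · rw [zpow_natCast, hQ.map_pow, hQ.map_a, mul_one]
  · rw [zpow_neg, zpow_natCast, hQ.map_inv, hQ.map_pow, hQ.map_a, mul_one]

theorem stay_pow (hQ : IsContracting χ a Q) {q : G} (hq : q ∈ Q) (k : ℕ) :
    (a ^ k)⁻¹ * q * a ^ k ∈ Q := by
  induction k with
  | zero => simpa using hq
  | succ k ih =>
    have := hQ.stay _ ih
    simpa only [pow_succ, mul_inv_rev, mul_assoc] using this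

theorem stay_zpow (hQ : IsContracting χ a Q) {q : G} (hq : q ∈ Q) {k : ℤ} (hk : 0 ≤ k) :
    (a ^ k)⁻¹ * q * a ^ k ∈ Q := by
  lift k to ℕ using hk
  simpa using hQ.stay_pow hq k

theorem one_mem (hQ : IsContracting χ a Q) : (1 : G) ∈ Q := by
  obtain ⟨k, hk⟩ := hQ.get 1 hQ.map_one
  simpa using hk

theorem lift_conj (g h : G) (t k : ℤ) : (a ^ k)⁻¹ * ((lift χ a g t)⁻¹ * lift χ a h t) * a ^ k =
    (lift χ a g (t + k))⁻¹ * lift χ a h (t + k) := by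
  have e : ∀ u : G, lift χ a u (t + k) = lift χ a u t * a ^ k := fun u => by
    rw [lift, lift, mul_assoc, ← zpow_add]; congr 2; ring
  rw [e, e]; group

theorem merged_mono (hQ : IsContracting χ a Q) {g h : G} {t t' : ℤ} (htt : t ≤ t')
    (H : Merged χ a Q g h t) : Merged χ a Q g h t' := by
  have := hQ.stay_zpow H (sub_nonneg.2 htt)
  rwa [lift_conj, add_sub_cancel] at this

theorem merged_symm (hQ : IsContracting χ a Q) {g h : G} {t : ℤ}
    (H : Merged χ a Q g h t) : Merged χ a Q h g t := by
  have := hQ.symm _ H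
  simpa [Merged] using this

theorem merged_trans (hQ : IsContracting χ a Q) : ∃ k : ℕ, ∀ g h u : G, ∀ t : ℤ,
    Merged χ a Q g h t → Merged χ a Q h u t → Merged χ a Q g u (t + k) := by
  obtain ⟨k, hk⟩ := hQ.prod
  refine ⟨k, fun g h u t h1 h2 => ?_⟩
  have := hk _ h1 _ h2
  have e : (lift χ a g t)⁻¹ * lift χ a h t * ((lift χ a h t)⁻¹ * lift χ a u t) =
      (lift χ a g t)⁻¹ * lift χ a u t := by group
  rw [e, ← zpow_natCast, lift_conj] at this
  exact this

theorem map_lift (hQ : IsContracting χ a Q) (g : G) (t : ℤ) : χ (lift χ a g t) = t := by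
  rw [lift, hQ.map_mul, hQ.map_zpow]; ring

theorem exists_merged (hQ : IsContracting χ a Q) (g h : G) : ∃ t, Merged χ a Q g h t := by
  obtain ⟨k, hk⟩ := hQ.get ((lift χ a g 0)⁻¹ * lift χ a h 0) (by
    rw [hQ.map_mul, hQ.map_inv, hQ.map_lift, hQ.map_lift]; rfl)
  rw [← zpow_natCast, lift_conj] at hk
  exact ⟨_, hk⟩

theorem mergeHeight_spec (hQ : IsContracting χ a Q) (g h : G) :
    χ g ≤ mergeHeight χ a Q g h ∧ χ h ≤ mergeHeight χ a Q g h ∧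
      Merged χ a Q g h (mergeHeight χ a Q g h) := by
  obtain ⟨t, ht⟩ := hQ.exists_merged g h
  have hne : {t | χ g ≤ t ∧ χ h ≤ t ∧ Merged χ a Q g h t}.Nonempty :=
    ⟨max t (max (χ g) (χ h)), by simp, by simp, hQ.merged_mono (le_max_left _ _) ht⟩
  exact Int.csInf_mem hne ⟨χ g, fun t ht => ht.1⟩

theorem mergeHeight_le {g h : G} {t : ℤ} (h1 : χ g ≤ t) (h2 : χ h ≤ t)
    (h3 : Merged χ a Q g h t) : mergeHeight χ a Q g h ≤ t :=
  csInf_le ⟨χ g, fun _ ht => ht.1⟩ ⟨h1, h2, h3⟩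

theorem mergeHeight_comm (hQ : IsContracting χ a Q) (g h : G) :
    mergeHeight χ a Q g h = mergeHeight χ a Q h g := by
  have key : ∀ g h, mergeHeight χ a Q g h ≤ mergeHeight χ a Q h g := fun g h => by
    obtain ⟨h1, h2, h3⟩ := hQ.mergeHeight_spec h g
    exact mergeHeight_le h2 h1 (hQ.merged_symm h3)
  exact le_antisymm (key _ _) (key _ _)

/-- At the larger of the two heights the crossings g → h and h → u both lie in Q; their product
needs only the k further conjugations of `prod`. -/
theorem mergeHeight_ultra (hQ : IsContracting χ a Q) : ∃ k : ℕ, ∀ g h u : G,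
    mergeHeight χ a Q g u ≤ max (mergeHeight χ a Q g h) (mergeHeight χ a Q h u) + k := by
  obtain ⟨k, hk⟩ := hQ.merged_trans
  refine ⟨k, fun g h u => ?_⟩
  obtain ⟨h1, h2, h3⟩ := hQ.mergeHeight_spec g h
  obtain ⟨h4, h5, h6⟩ := hQ.mergeHeight_spec h u
  refine mergeHeight_le (by omega) (by omega)
    (hk g h u _ (hQ.merged_mono (le_max_left _ _) h3) (hQ.merged_mono (le_max_right _ _) h6))

/-- Halving the list costs `k` conjugations per step, so the number of conjugations is logarithmic
in the number of factors. -/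
theorem list_prod_mem (hQ : IsContracting χ a Q) : ∃ k : ℕ, ∀ (i : ℕ) (l : List G),
    (∀ x ∈ l, x ∈ Q) → l.length ≤ 2 ^ i → (a ^ (k * i))⁻¹ * l.prod * a ^ (k * i) ∈ Q := by
  obtain ⟨k, hk⟩ := hQ.prod
  refine ⟨k, fun i => ?_⟩
  induction i with
  | zero =>
    intro l hl hlen
    match l, hlen with
    | [], _ => simpa using hQ.one_mem
    | [x], _ => simpa using hl x (by simp)
  | succ i ih =>
    intro l hl hlen
    have h1 := ih (l.take (2 ^ i)) (fun x hx => hl x (List.mem_of_mem_take hx)) (by simp)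
    have h2 := ih (l.drop (2 ^ i)) (fun x hx => hl x (List.mem_of_mem_drop hx)) (by
      rw [pow_succ] at hlen
      simp; omega)
    have := hk _ h1 _ h2
    rw [← List.take_append_drop (2 ^ i) l, List.prod_append]
    convert this using 1
    rw [Nat.mul_succ, pow_add]
    group

theorem list_conj (hQ : IsContracting χ a Q) (l : List G) (hl : ∀ x ∈ l, x ∈ Q) :
    ∃ l' : List G, l'.length = l.length ∧ (∀ x ∈ l', x ∈ Q) ∧ l'.prod = a⁻¹ * l.prod * a := by
  induction l with
  | nil => exact ⟨[], rfl, by simp, by simp⟩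
  | cons x l ih =>
    obtain ⟨m, h1, h2, h3⟩ := ih fun y hy => hl y (List.mem_cons_of_mem _ hy)
    refine ⟨(a⁻¹ * x * a) :: m, by simp [h1], ?_, ?_⟩
    · intro y hy
      rcases List.mem_cons.1 hy with rfl | hy
      exacts [hQ.stay _ (hl x (by simp)), h2 y hy]
    · rw [List.prod_cons, List.prod_cons, h3]; group

end IsContracting

theorem exists_log_bound (K : ℕ) : ∃ C : ℕ, ∀ R : ℕ, ∃ i : ℕ, R ≤ 2 ^ i ∧ K * i ≤ R + C := by
  refine ⟨K * (2 * K + 1), fun R => ?_⟩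
  induction R using Nat.strong_induction_on with
  | _ R ih =>
    by_cases hR : R < 2 * K + 1
    · exact ⟨2 * K + 1, hR.le.trans (Nat.lt_two_pow_self).le, by omega⟩
    · rcases Nat.eq_zero_or_pos K with rfl | hK
      · exact ⟨R, (Nat.lt_two_pow_self).le, by simp⟩
      obtain ⟨i, h1, h2⟩ := ih ((R + 1) / 2) (by omega)
      exact ⟨i + 1, by rw [pow_succ]; omega, by rw [Nat.mul_succ]; omega⟩

namespace IsAdapted

variable {χ : G → ℤ} {a : G} {Q : Set G} {P : Subgroup G} {B : Set G}

theorem letter (hB : IsAdapted χ a Q P B) (hQ : IsContracting χ a Q) {x : G}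
    (hx : x ∈ B ∨ x⁻¹ ∈ B) : x ∈ Q ∨ (|χ x| ≤ 1 ∧ a ^ (-χ x) * x ∈ P) := by
  rcases hx with hx | hx
  · exact hB.letters x hx
  · rcases hB.letters _ hx with h | ⟨h1, h2⟩
    · left; simpa using hQ.symm _ h
    · right
      rw [hQ.map_inv] at h1 h2
      refine ⟨by simpa using h1, ?_⟩
      have hc : Commute (a ^ (-χ x)) (a ^ (-(-χ x)) * x⁻¹) :=
        (show Commute a (a ^ (-(-χ x)) * x⁻¹) from hB.comm _ h2).zpow_left _
      have := P.inv_mem h2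
      have h3 : x⁻¹ = a ^ (-(-χ x)) * x⁻¹ * a ^ (-χ x) := by rw [← hc.eq]; group
      have h4 : x = (a ^ (-(-χ x)) * x⁻¹ * a ^ (-χ x))⁻¹ := by rw [← h3, inv_inv]
      have h5 : a ^ (-χ x) * x = (a ^ (-(-χ x)) * x⁻¹)⁻¹ := by
        calc a ^ (-χ x) * x = a ^ (-χ x) * (a ^ (-(-χ x)) * x⁻¹ * a ^ (-χ x))⁻¹ := by rw [← h4]
          _ = _ := by group
      rwa [h5]

/-- Any path can be lifted to a single height `T` above its end points: letters of Q stay in Q when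
conjugated upwards, and vertical letters pay for the climb and the descent. The last inequality says
that this rearrangement costs at most one letter. -/
theorem path_bound (hB : IsAdapted χ a Q P B) (hQ : IsContracting χ a Q) (w : List G)
    (hw : IsWord B w) (g : G) : ∃ (T : ℤ) (l : List G), χ g ≤ T ∧ χ (g * w.prod) ≤ T ∧
      (∀ x ∈ l, x ∈ Q) ∧ 1 ≤ l.length ∧ l.prod = (lift χ a g T)⁻¹ * lift χ a (g * w.prod) T ∧
      2 * T - χ g - χ (g * w.prod) + l.length ≤ w.length + 1 := by
  induction w generalizing g with
  | nil =>
    -- The list is never empty, so that its head can absorb elements of `P`; this accounts for the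
    -- `+ 1` in the bound.
    refine ⟨χ g, [1], le_rfl, by simp, by simpa using hQ.one_mem, by simp, by simp, ?_⟩
    simp; omega
  | cons x w ih =>
    obtain ⟨T, l, h1, h2, h3, h4, h5, h6⟩ := ih (fun y hy => hw y (List.mem_cons_of_mem _ hy)) (g * x)
    have e : g * (x :: w).prod = g * x * w.prod := by simp [mul_assoc]
    rw [e]
    simp only [List.length_cons]
    set g' := g * x * w.prod with hg'
    rw [hQ.map_mul] at h1 h6
    rcases hB.letter hQ (hw x (by simp)) with hx | ⟨hx1, hx2⟩
    · have hx0 := hQ.ker x hx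
      refine ⟨T, ((a ^ (T - χ g))⁻¹ * x * a ^ (T - χ g)) :: l, by omega, h2, ?_, by simp, ?_, ?_⟩
      · intro y hy
        rcases List.mem_cons.1 hy with rfl | hy
        exacts [hQ.stay_zpow hx (by omega), h3 y hy]
      · rw [List.prod_cons, h5]
        simp only [lift, hQ.map_mul, hx0, add_zero]
        group
      · simp only [List.length_cons]; push_cast; omega
    · set p := a ^ (-χ x) * x with hp
      have hxp : x = a ^ χ x * p := by rw [hp]; group
      have hl : ∀ t, lift χ a (g * x) t = lift χ a g t * p := by
        intro t
        have hc : Commute (a ^ (t - χ (g * x))) p :=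
          (show Commute a p from hB.comm _ hx2).zpow_left _
        rw [lift, lift, mul_assoc g x, hxp, mul_assoc (a ^ χ x), ← hxp, ← hc.eq, ← mul_assoc _ _ p,
          ← zpow_add, ← mul_assoc, hQ.map_mul]
        congr 3; ring
      have key : ∀ (T' : ℤ) (m : List G), χ g ≤ T' → χ g' ≤ T' → (∀ y ∈ m, y ∈ Q) →
          m.length = l.length → m.prod = (lift χ a (g * x) T')⁻¹ * lift χ a g' T' →
          2 * T' - χ g - χ g' + l.length ≤ (w.length : ℤ) + 1 + 1 →
          ∃ (T : ℤ) (l : List G), χ g ≤ T ∧ χ g' ≤ T ∧ (∀ x ∈ l, x ∈ Q) ∧ 1 ≤ l.length ∧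
            l.prod = (lift χ a g T)⁻¹ * lift χ a g' T ∧
            2 * T - χ g - χ g' + l.length ≤ ((w.length + 1 : ℕ) : ℤ) + 1 := by
        intro T' m k1 k2 k3 k4 k5 k6
        match m, k4, k3, k5 with
        | [], k4, _, _ => simp at k4; omega
        | y :: m, k4, k3, k5 =>
          refine ⟨T', (p * y) :: m, k1, k2, ?_, by simp, ?_, ?_⟩
          · intro z hz
            rcases List.mem_cons.1 hz with rfl | hz
            exacts [hB.absorb _ hx2 _ (k3 y (by simp)), k3 z (List.mem_cons_of_mem _ hz)]
          · rw [List.prod_cons] at k5 ⊢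
            rw [mul_assoc, k5, hl]; group
          · simp only [List.length_cons] at k4 ⊢; push_cast; omega
      rw [abs_le] at hx1
      -- `T` is too low only if `x` descends and `T = χ g - 1`. Raising `T` by one then increases
      -- the cost by one, which the letter `x` pays for.
      by_cases hT : χ g ≤ T
      · exact key T l hT h2 h3 rfl h5 (by omega)
      · obtain ⟨m, m1, m2, m3⟩ := hQ.list_conj l h3
        refine key (T + 1) m (by omega) (by omega) m2 m1 ?_ (by omega)
        rw [m3, h5]
        have := IsContracting.lift_conj (χ := χ) (a := a) (g * x) g' T 1
        simpa using this

end IsAdapted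

namespace IsAdapted

variable {χ : G → ℤ} {a : G} {Q : Set G} {P : Subgroup G} {B : Set G}

theorem isWord_replicate (hB : IsAdapted χ a Q P B) (k : ℕ) :
    IsWord B (List.replicate k a) ∧ IsWord B (List.replicate k a⁻¹) := by
  constructor <;> intro x hx <;> obtain rfl := List.eq_of_mem_replicate hx
  exacts [Or.inl hB.mem, Or.inr (by simpa using hB.mem)]

theorem closure_eq_top (hB : IsAdapted χ a Q P B) (hQ : IsContracting χ a Q) :
    Subgroup.closure B = ⊤ := by
  have ha : a ∈ Subgroup.closure B := Subgroup.subset_closure hB.mem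
  have hq : ∀ q ∈ Q, q ∈ Subgroup.closure B := by
    intro q hq
    obtain ⟨K, hK⟩ := hB.bounded
    obtain ⟨l, hl, -, rfl⟩ := hK q hq
    refine Subgroup.list_prod_mem _ fun x hx => ?_
    rcases hl x hx with h | h
    · exact Subgroup.subset_closure h
    · simpa using Subgroup.inv_mem _ (Subgroup.subset_closure h)
  rw [eq_top_iff]
  intro g _
  obtain ⟨k, hk⟩ := hQ.get (g * a ^ (-χ g)) (by rw [hQ.map_mul, hQ.map_zpow]; omega)
  have : g = a ^ k * ((a ^ k)⁻¹ * (g * a ^ (-χ g)) * a ^ k) * (a ^ k)⁻¹ * a ^ χ g := by group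
  rw [this]
  exact mul_mem (mul_mem (mul_mem (pow_mem ha _) (hq _ hk)) (inv_mem (pow_mem ha _)))
    (zpow_mem ha _)

/-- The word metric is determined by the heights at which vertical rays merge, up to an additive
error. -/
theorem dist_estimate (hQ : IsContracting χ a Q) :
    ∃ C₀ : ℤ, ∀ (P : Subgroup G) (B : Set G), IsAdapted χ a Q P B → ∀ (g : G) (w : List G),
      IsWord B w →
      2 * mergeHeight χ a Q g (g * w.prod) - χ g - χ (g * w.prod) - C₀ ≤ w.length := by
  obtain ⟨k, hk⟩ := hQ.list_prod_mem
  -- The height enters the length estimate twice, hence `2 * k`.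
  obtain ⟨C, hC⟩ := exists_log_bound (2 * k)
  refine ⟨C + 1, fun P B hB g w hw => ?_⟩
  obtain ⟨T, l, h1, h2, h3, -, h5, h6⟩ := hB.path_bound hQ w hw g
  obtain ⟨i, hi, hi'⟩ := hC l.length
  have := hk i l h3 hi
  rw [h5, ← zpow_natCast, IsContracting.lift_conj] at this
  change Merged χ a Q g (g * w.prod) (T + ↑(k * i)) at this
  have hm := IsContracting.mergeHeight_le (χ := χ) (g := g) (h := g * w.prod)
    (t := T + ↑(k * i)) (by omega) (by omega) this
  have e : 2 * k * i = 2 * (k * i) := by ring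
  rw [e] at hi'
  omega

theorem wordLength_estimate (hQ : IsContracting χ a Q) (A : GenSet G)
    (hB : IsAdapted χ a Q P A.carrier) : ∃ C : ℤ, ∀ g h : G,
      |@dist (Cay A) _ g h - (2 * mergeHeight χ a Q g h - χ g - χ h : ℤ)| ≤ C := by
  obtain ⟨C₀, hC₀⟩ := dist_estimate hQ
  obtain ⟨K, hK⟩ := hB.bounded
  refine ⟨max C₀ K, fun g h => ?_⟩
  change |((wordLength A.carrier (g⁻¹ * h) : ℕ) : ℝ) - _| ≤ _
  rw [abs_le]
  constructor
  · obtain ⟨w, hw, hlen, hprod⟩ := A.exists_word (g⁻¹ * h)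
    have h1 := hC₀ P _ hB g w hw
    rw [hprod, mul_inv_cancel_left, hlen] at h1
    have : 2 * mergeHeight χ a Q g h - χ g - χ h - max C₀ K ≤
      (wordLength A.carrier (g⁻¹ * h) : ℤ) := by omega
    have : ((2 * mergeHeight χ a Q g h - χ g - χ h - max C₀ K : ℤ) : ℝ) ≤
      ((wordLength A.carrier (g⁻¹ * h) : ℤ) : ℝ) := by exact_mod_cast this
    push_cast at this ⊢
    linarith
  · obtain ⟨h1, h2, h3⟩ := hQ.mergeHeight_spec g h
    set t := mergeHeight χ a Q g h
    obtain ⟨w, hw, hlen, hprod⟩ := hK _ h3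
    obtain ⟨i, hi⟩ := Int.eq_ofNat_of_zero_le (sub_nonneg.2 h1)
    obtain ⟨j, hj⟩ := Int.eq_ofNat_of_zero_le (sub_nonneg.2 h2)
    have hword := ((hB.isWord_replicate i).1.append hw).append (hB.isWord_replicate j).2
    have hle := wordLength_le hword
    have hp : (List.replicate i a ++ w ++ List.replicate j a⁻¹).prod = g⁻¹ * h := by
      rw [List.prod_append, List.prod_append, List.prod_replicate, List.prod_replicate, hprod, lift,
        lift, hi, hj]
      simp only [zpow_natCast]
      group
    rw [hp] at hle
    simp only [List.length_append, List.length_replicate] at hle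
    have : (wordLength A.carrier (g⁻¹ * h) : ℤ) ≤
      2 * t - χ g - χ h + max C₀ K := by omega
    have : ((wordLength A.carrier (g⁻¹ * h) : ℤ) : ℝ) ≤
      ((2 * t - χ g - χ h + max C₀ K : ℤ) : ℝ) := by exact_mod_cast this
    push_cast at this ⊢
    linarith

theorem gromovProduct_estimate (hQ : IsContracting χ a Q) (A : GenSet G)
    (hB : IsAdapted χ a Q P A.carrier) : ∃ C : ℤ, ∀ o g h : G,
      |gromovProduct (X := Cay A) o g h - (mergeHeight χ a Q g o + mergeHeight χ a Q h o -
        mergeHeight χ a Q g h - χ o : ℤ)| ≤ C := by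
  obtain ⟨C, hC⟩ := wordLength_estimate hQ A hB
  refine ⟨2 * C, fun o g h => ?_⟩
  have h1 := abs_le.1 (hC g o)
  have h2 := abs_le.1 (hC h o)
  have h3 := abs_le.1 (hC g h)
  rw [abs_le]
  push_cast at *
  simp only [gromovProduct]
  constructor <;> linarith

/-- In terms of the merging height m, the four-point condition reads m(x,z) + m(y,o) ≤ max(m(x,y) +
m(z,o), m(y,z) + m(x,o)) up to a constant, and every ultrametric satisfies it. -/
theorem isGromovHyperbolic (hQ : IsContracting χ a Q) (A : GenSet G)
    (hB : IsAdapted χ a Q P A.carrier) : IsGromovHyperbolic (Cay A) := by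
  obtain ⟨C, hC⟩ := gromovProduct_estimate hQ A hB
  obtain ⟨k, hk⟩ := hQ.mergeHeight_ultra
  refine ⟨2 * C + 2 * k, fun o x y z => ?_⟩
  have h1 := abs_le.1 (hC o x y)
  have h2 := abs_le.1 (hC o y z)
  have h3 := abs_le.1 (hC o x z)
  have hs := hQ.mergeHeight_comm
  have key : min (mergeHeight χ a Q x o + mergeHeight χ a Q y o - mergeHeight χ a Q x y - χ o)
      (mergeHeight χ a Q y o + mergeHeight χ a Q z o - mergeHeight χ a Q y z - χ o) ≤
      mergeHeight χ a Q x o + mergeHeight χ a Q z o - mergeHeight χ a Q x z - χ o + 2 * k := by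
    have a1 := hk x y o
    have a2 := hk y x o
    have a3 := hk x o y
    have a4 := hk y z o
    have a5 := hk z y o
    have a6 := hk y o z
    have a7 := hk x z o
    have a8 := hk z x o
    have a9 := hk x o z
    have a10 := hk x y z
    have a11 := hk x z y
    have a12 := hk y x z
    rw [hs y x] at *
    rw [hs o y] at *
    rw [hs z y] at *
    rw [hs o z] at *
    rw [hs z x] at *
    omega
  have key' : ((min (mergeHeight χ a Q x o + mergeHeight χ a Q y o - mergeHeight χ a Q x y - χ o)
      (mergeHeight χ a Q y o + mergeHeight χ a Q z o - mergeHeight χ a Q y z - χ o) : ℤ) : ℝ) ≤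
      ((mergeHeight χ a Q x o + mergeHeight χ a Q z o - mergeHeight χ a Q x z - χ o + 2 * k : ℤ) : ℝ) :=
    by exact_mod_cast key
  rw [Int.cast_min] at key'
  rcases min_le_iff.1 key' with h | h
  · refine le_trans (sub_le_sub_right (min_le_left _ _) _) ?_
    rw [Int.cast_add] at h
    push_cast at *
    linarith
  · refine le_trans (sub_le_sub_right (min_le_right _ _) _) ?_
    rw [Int.cast_add] at h
    push_cast at *
    linarith

/-- A short word in ker χ ends close to the identity, so its line merges with that of 1 at bounded
height, and merging at height N is membership of the conjugate by a^N in Q. -/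
theorem conj_mem_of_word (hQ : IsContracting χ a Q) (hB : IsAdapted χ a Q P B) (K : ℕ) :
    ∃ N : ℕ, ∀ w, IsWord B w → w.length ≤ K → χ w.prod = 0 →
      (a ^ N)⁻¹ * w.prod * a ^ N ∈ Q := by
  obtain ⟨C₀, hC₀⟩ := dist_estimate hQ
  refine ⟨(K + C₀).toNat, fun w hw hlen h0 => ?_⟩
  have h1 := hC₀ P B hB 1 w hw
  obtain ⟨h2, h3, h4⟩ := hQ.mergeHeight_spec 1 (1 * w.prod)
  rw [one_mul] at *
  rw [hQ.map_one] at *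
  have := hQ.merged_mono (t' := ((K + C₀).toNat : ℤ)) (by omega) h4
  rw [Merged, lift, lift, hQ.map_one, h0, sub_zero, zpow_natCast, one_mul, ← mul_assoc] at this
  exact this

end IsAdapted

-- Vertical rays, the limit set and the Busemann pseudocharacter.

namespace IsContracting

variable {χ : G → ℤ} {a : G} {Q : Set G}

theorem lift_mul_zpow (hQ : IsContracting χ a Q) (g : G) (k t : ℤ) :
    lift χ a (g * a ^ k) t = lift χ a g t := by
  rw [lift, lift, hQ.map_mul, hQ.map_zpow, mul_assoc, ← zpow_add]
  congr 2; ring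

theorem mergeHeight_line (hQ : IsContracting χ a Q) {g h : G} {t k l : ℤ}
    (ht : Merged χ a Q g h t) (hkl : t ≤ max (χ g + k) (χ h + l)) :
    mergeHeight χ a Q (g * a ^ k) (h * a ^ l) = max (χ g + k) (χ h + l) := by
  obtain ⟨h1, h2, -⟩ := hQ.mergeHeight_spec (g * a ^ k) (h * a ^ l)
  have e1 : χ (g * a ^ k) = χ g + k := by rw [hQ.map_mul, hQ.map_zpow]
  have e2 : χ (h * a ^ l) = χ h + l := by rw [hQ.map_mul, hQ.map_zpow]
  rw [e1] at h1
  rw [e2] at h2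
  refine le_antisymm (mergeHeight_le (by omega) (by omega) ?_) (max_le h1 h2)
  rw [Merged, hQ.lift_mul_zpow, hQ.lift_mul_zpow]
  exact hQ.merged_mono hkl ht

theorem merged_self (hQ : IsContracting χ a Q) (g : G) (t : ℤ) : Merged χ a Q g g t := by
  rw [Merged, inv_mul_cancel]
  exact hQ.one_mem

end IsContracting

namespace IsAdapted

variable {χ : G → ℤ} {a : G} {Q : Set G} {P : Subgroup G}

/-- Any two vertical lines merge eventually, hence the translate by `g` of the upward ray from 1
defines the same boundary point. The factor 1 makes both sequences match the general shape of
`mergeHeight_line`. -/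
theorem seqAsymptotic_up (hQ : IsContracting χ a Q) (A : GenSet G)
    (hB : IsAdapted χ a Q P A.carrier) (g : G) :
    SeqAsymptotic (X := Cay A) (fun i : ℕ => g * (1 * a ^ (i : ℤ)))
      (fun i : ℕ => (1 : G) * a ^ (i : ℤ)) := by
  suffices H : SeqAsymptotic (X := Cay A) (fun i : ℕ => g * a ^ (i : ℤ))
      (fun i : ℕ => (1 : G) * a ^ (i : ℤ)) by
    have e : (fun i : ℕ => g * (1 * a ^ (i : ℤ))) = fun i : ℕ => g * a ^ (i : ℤ) := by simp
    exact e ▸ H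
  obtain ⟨C, hC⟩ := gromovProduct_estimate hQ A hB
  obtain ⟨t, ht⟩ := hQ.exists_merged g 1
  refine SeqAsymptotic.of_base (X := Cay A) (1 : G) ?_
  rw [tendsto_atTop]
  intro b
  obtain ⟨N, hN⟩ := exists_nat_ge (b + C)
  filter_upwards [eventually_ge_atTop ((N + (t - χ g).toNat + (-χ g).toNat, N) : ℕ × ℕ)] with p hp
  obtain ⟨hp1, hp2⟩ := hp
  simp only at hp1 hp2
  have h1 := abs_le.1 (hC 1 (g * a ^ (p.1 : ℤ)) (1 * a ^ (p.2 : ℤ)))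
  have e0 := hQ.map_one
  have e1 := hQ.mergeHeight_line (k := p.1) (l := p.2) ht (by omega)
  have e2 := hQ.mergeHeight_line (k := p.1) (l := 0) ht (by omega)
  have e3 := hQ.mergeHeight_line (k := p.2) (l := 0) (hQ.merged_self 1 0) (by omega)
  rw [zpow_zero, mul_one] at e2 e3
  rw [e1, e2, e3, e0] at h1
  have : (N : ℤ) ≤ max (χ g + p.1) (0 + 0) + max (0 + (p.2 : ℤ)) (0 + 0) - max (χ g + p.1) (0 + p.2) - 0 := by
    omega
  have : ((N : ℤ) : ℝ) ≤ ((max (χ g + p.1) (0 + 0) + max (0 + (p.2 : ℤ)) (0 + 0) -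
    max (χ g + p.1) (0 + p.2) - 0 : ℤ) : ℝ) := by exact_mod_cast this
  rw [Int.cast_natCast] at this
  linarith [h1.1]

theorem seqAsymptotic_down (hQ : IsContracting χ a Q) (A : GenSet G)
    (hB : IsAdapted χ a Q P A.carrier) (g : G) :
    SeqAsymptotic (X := Cay A) (fun i : ℕ => g * a ^ (-i : ℤ)) (fun i : ℕ => g * a ^ (-i : ℤ)) := by
  obtain ⟨C, hC⟩ := gromovProduct_estimate hQ A hB
  refine SeqAsymptotic.of_base (X := Cay A) g ?_
  rw [tendsto_atTop]
  intro b
  obtain ⟨N, hN⟩ := exists_nat_ge (b + C)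
  filter_upwards [eventually_ge_atTop ((N, N) : ℕ × ℕ)] with p hp
  obtain ⟨hp1, hp2⟩ := hp
  simp only at hp1 hp2
  have h1 := abs_le.1 (hC g (g * a ^ (-p.1 : ℤ)) (g * a ^ (-p.2 : ℤ)))
  have e1 := hQ.mergeHeight_line (k := -p.1) (l := -p.2)
    (hQ.merged_self g (max (χ g + -p.1) (χ g + -p.2))) le_rfl
  have e2 := hQ.mergeHeight_line (k := -p.1) (l := 0)
    (hQ.merged_self g (max (χ g + -p.1) (χ g + 0))) le_rfl
  have e3 := hQ.mergeHeight_line (k := -p.2) (l := 0)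
    (hQ.merged_self g (max (χ g + -p.2) (χ g + 0))) le_rfl
  rw [zpow_zero, mul_one] at e2 e3
  rw [e1, e2, e3] at h1
  have : (N : ℤ) ≤ max (χ g + -p.1) (χ g + 0) + max (χ g + -p.2) (χ g + 0) -
    max (χ g + -p.1) (χ g + -p.2) - χ g := by
    omega
  have : ((N : ℤ) : ℝ) ≤ ((max (χ g + -p.1) (χ g + 0) + max (χ g + -p.2) (χ g + 0) -
    max (χ g + -p.1) (χ g + -p.2) - χ g : ℤ) : ℝ) := by exact_mod_cast this
  rw [Int.cast_natCast] at this
  linarith [h1.1]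

/-- The merging heights of descending points with the line through 1 stay bounded, so a Gromov
product tending to infinity forces the merging heights of the two rays towards -∞. -/
theorem merged_of_seqAsymptotic_down (hQ : IsContracting χ a Q) (A : GenSet G)
    (hB : IsAdapted χ a Q P A.carrier) {g h : G}
    (H : SeqAsymptotic (X := Cay A) (fun i : ℕ => g * a ^ (-i : ℤ)) (fun i : ℕ => h * a ^ (-i : ℤ)))
    (t : ℤ) : Merged χ a Q g h t := by
  obtain ⟨C, hC⟩ := gromovProduct_estimate hQ A hB
  have hbd : ∀ g : G, ∃ T : ℤ, ∀ k : ℕ, mergeHeight χ a Q (g * a ^ (-k : ℤ)) 1 ≤ T := by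
    intro g
    obtain ⟨s, hs⟩ := hQ.exists_merged g 1
    refine ⟨max s (max (χ g) 0), fun k => IsContracting.mergeHeight_le ?_ ?_ ?_⟩
    · rw [hQ.map_mul, hQ.map_zpow]; omega
    · rw [hQ.map_one]; omega
    · rw [Merged, hQ.lift_mul_zpow]
      exact hQ.merged_mono (le_max_left _ _) hs
  obtain ⟨T, hT⟩ := hbd g
  obtain ⟨T', hT'⟩ := hbd h
  obtain ⟨p, hp⟩ := ((tendsto_atTop.1 (H (1 : G))) ((T + T' - t + C : ℤ) : ℝ)).exists
  replace hp : ((T + T' - t + C : ℤ) : ℝ) ≤ gromovProduct (X := Cay A) (1 : G)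
    (g * a ^ (-p.1 : ℤ) : G) (h * a ^ (-p.2 : ℤ) : G) := hp
  have h1 := abs_le.1 (hC 1 (g * a ^ (-p.1 : ℤ)) (h * a ^ (-p.2 : ℤ)))
  have h2 := hT p.1
  have h3 := hT' p.2
  set m := mergeHeight χ a Q (g * a ^ (-p.1 : ℤ)) (h * a ^ (-p.2 : ℤ)) with hm
  have h4 : ((T + T' - t + C : ℤ) : ℝ) ≤ ((mergeHeight χ a Q (g * a ^ (-p.1 : ℤ)) 1 +
      mergeHeight χ a Q (h * a ^ (-p.2 : ℤ)) 1 - m - χ 1 + C : ℤ) : ℝ) := by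
    rw [Int.cast_add _ C, Int.cast_add _ C]
    rw [Int.cast_add _ C] at hp
    linarith [h1.2]
  rw [Int.cast_le, hQ.map_one] at h4
  obtain ⟨-, -, h5⟩ := hQ.mergeHeight_spec (g * a ^ (-p.1 : ℤ)) (h * a ^ (-p.2 : ℤ))
  rw [Merged, hQ.lift_mul_zpow, hQ.lift_mul_zpow] at h5
  exact hQ.merged_mono (by omega) h5

theorem limitSet_infinite (hQ : IsContracting χ a Q) (A : GenSet G)
    (hB : IsAdapted χ a Q P A.carrier) (hs : ∃ x ∈ Q, a * x * a⁻¹ ∉ Q) :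
    (limitSet (Cay A) G).Infinite := by
  obtain ⟨x, hx, hxa⟩ := hs
  obtain ⟨k, hk⟩ := hQ.prod
  have hyp := isGromovHyperbolic hQ A hB
  -- The spacing `k + 1` exceeds by one the `k` conjugations lost in a product. If two of these
  -- downward rays had the same end point, multiplying the crossing at the height i(k+1) by `x` and
  -- conjugating would give `a * x * a⁻¹ ∈ Q`.
  let h : ℕ → G := fun j => a ^ (j * (k + 1)) * x * (a ^ (j * (k + 1)))⁻¹
  let y : ℕ → SeqToInfinity (Cay A) := fun j =>
    ⟨fun i : ℕ => h j * a ^ (-i : ℤ), seqAsymptotic_down hQ A hB (h j)⟩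
  have key : ∀ i j, i < j → (Quot.mk _ (y i) : GromovBoundary (Cay A)) ≠ Quot.mk _ (y j) := by
    intro i j hij he
    rw [boundary_eq_iff hyp] at he
    have hm := merged_of_seqAsymptotic_down hQ A hB he (i * (k + 1) : ℕ)
    have hχ : ∀ j, χ (h j) = 0 := fun j => by
      simp only [h, hQ.map_mul, hQ.map_inv, hQ.ker x hx]; ring
    rw [Merged, lift, lift, hχ, hχ, sub_zero, zpow_natCast] at hm
    have := hk _ hx _ hm
    obtain ⟨d, rfl⟩ : ∃ d, j = i + 1 + d := ⟨j - (i + 1), by omega⟩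
    refine hxa ?_
    have h2 := hQ.stay_pow this (d * (k + 1))
    have e1 : (i + 1 + d) * (k + 1) = i * (k + 1) + 1 + k + d * (k + 1) := by ring
    convert h2 using 1
    simp only [h, e1, pow_add, pow_one]
    group
  refine Set.infinite_of_injective_forall_mem (f := fun j => Quot.mk _ (y j)) ?_ ?_
  · intro i j hij
    by_contra hne
    rcases lt_or_gt_of_ne hne with hlt | hlt
    exacts [key i j hlt hij, key j i hlt hij.symm]
  · intro j
    refine ⟨y j, ⟨(1 : G), fun i => ⟨h j * a ^ (-i : ℤ), ?_⟩⟩, rfl⟩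
    exact mul_one (h j * a ^ (-i : ℤ) : G)

theorem isQuasiParabolicWith (hQ : IsContracting χ a Q) (A : GenSet G)
    (hB : IsAdapted χ a Q P A.carrier) (hs : ∃ x ∈ Q, a * x * a⁻¹ ∉ Q) :
    IsQuasiParabolicWith (Cay A) (fun g : G => (χ g : ℝ)) := by
  let x : SeqToInfinity (Cay A) :=
    ⟨fun i : ℕ => (1 : G) * a ^ (i : ℤ), by
      have e : (fun i : ℕ => (1 : G) * (1 * a ^ (i : ℤ))) = fun i : ℕ => 1 * a ^ (i : ℤ) := by simp
      exact e ▸ seqAsymptotic_up hQ A hB 1⟩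
  refine ⟨limitSet_infinite hQ A hB hs, Quot.mk _ x, fun g => Quot.sound ?_, 1, one_pos, x, rfl,
    (1 : G), fun g => ?_⟩
  · exact seqAsymptotic_up hQ A hB g
  · obtain ⟨C, hC⟩ := wordLength_estimate hQ A hB
    let f : ℕ → ℕ → ℝ := fun k i => @dist (Cay A) _ (1 : G) (1 * a ^ (i : ℤ) : G) -
      @dist (Cay A) _ (g ^ k * 1 : G) (1 * a ^ (i : ℤ) : G)
    change Tendsto (fun k : ℕ => limsup (f k) atTop / (k : ℝ)) atTop (𝓝 (1 * (χ g : ℝ)))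
    -- For large i the lines through 1 and g^k have merged below the height i of a^i; the distances
    -- are then i and i - kχ(g) up to `C`. Dividing by k removes the error.
    have hb : ∀ k : ℕ, ∀ᶠ i in atTop, |f k i - k * χ g| ≤ 2 * C := by
      intro k
      obtain ⟨t, ht⟩ := hQ.exists_merged (g ^ k) 1
      filter_upwards [eventually_ge_atTop (t.toNat + (χ (g ^ k)).toNat)] with i hi
      have e0 := hQ.map_one
      have e1 := hQ.mergeHeight_line (k := 0) (l := i) (hQ.merged_self 1 0) (by omega)
      have e2 := hQ.mergeHeight_line (k := 0) (l := i) ht (by omega)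
      have e3 : χ (1 * a ^ (i : ℤ)) = i := by rw [one_mul, hQ.map_zpow]
      rw [zpow_zero, mul_one] at e1 e2
      have h1 := hC 1 (1 * a ^ (i : ℤ))
      have h2 := hC (g ^ k) (1 * a ^ (i : ℤ))
      rw [e1, e3, e0, max_eq_right (by omega)] at h1
      rw [e2, e3, e0, max_eq_right (by omega), hQ.map_pow] at h2
      simp only [f]
      rw [mul_one]
      rw [abs_le] at *
      push_cast at *
      constructor <;> linarith
    have hlim : ∀ k : ℕ, |limsup (fun i => f k i) atTop - k * χ g| ≤ 2 * C := by
      intro k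
      have h1 : ∀ᶠ i in atTop, f k i ≤ k * χ g + 2 * C :=
        (hb k).mono fun i hi => by linarith [(abs_le.1 hi).2]
      have h2 : ∀ᶠ i in atTop, k * χ g - 2 * C ≤ f k i :=
        (hb k).mono fun i hi => by linarith [(abs_le.1 hi).1]
      have b1 : IsBoundedUnder (· ≤ ·) atTop (fun i => f k i) := ⟨_, h1⟩
      have b2 : IsBoundedUnder (· ≥ ·) atTop (fun i => f k i) := ⟨_, h2⟩
      have l1 := limsup_le_of_le b2.isCoboundedUnder_le h1
      have l2 := le_limsup_of_frequently_le h2.frequently b1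
      rw [abs_le]
      constructor <;> linarith
    rw [tendsto_iff_norm_sub_tendsto_zero]
    refine squeeze_zero' (g := fun k : ℕ => (2 * C : ℝ) / k) (Eventually.of_forall fun _ => norm_nonneg _)
      ?_ (tendsto_const_div_atTop_nhds_zero_nat _)
    filter_upwards [eventually_gt_atTop 0] with k hk
    have hk' : (0 : ℝ) < k := Nat.cast_pos.2 hk
    rw [le_div_iff₀ hk', Real.norm_eq_abs]
    refine le_trans (le_of_eq ?_) (hlim k)
    nth_rewrite 2 [← abs_of_pos hk']
    rw [← abs_mul, sub_mul, div_mul_cancel₀ _ hk'.ne', one_mul, mul_comm (χ g : ℝ)]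

end IsAdapted

end Contracting

-- The action of F_n on [0, 1] and germs at 0.

section Thompson

local notation "I" => unitInterval

variable {n : ℕ} [n.AtLeastTwo]

theorem two_le_cast (n : ℕ) [n.AtLeastTwo] : (2 : ℝ) ≤ n := by
  exact_mod_cast Nat.AtLeastTwo.prop

theorem act_mul (x : I) (g h : ThompsonF n) : act x (g * h) = act (act x g) h := rfl

@[simp] theorem act_one (x : I) : act x (1 : ThompsonF n) = x := rfl

@[simp] theorem act_act_inv (x : I) (g : ThompsonF n) : act (act x g) g⁻¹ = x := by
  rw [← act_mul, mul_inv_cancel, act_one]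

@[simp] theorem act_inv_act (x : I) (g : ThompsonF n) : act (act x g⁻¹) g = x := by
  rw [← act_mul, inv_mul_cancel, act_one]

theorem act_strictMono (g : ThompsonF n) : StrictMono fun x : I => act x g := g.1.unop.strictMono

@[simp] theorem act_lt_act {x y : I} {g : ThompsonF n} : act x g < act y g ↔ x < y :=
  (act_strictMono g).lt_iff_lt

@[simp] theorem act_le_act {x y : I} {g : ThompsonF n} : act x g ≤ act y g ↔ x ≤ y :=
  (act_strictMono g).le_iff_le

theorem act_inj {x y : I} {g : ThompsonF n} : act x g = act y g ↔ x = y :=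
  (act_strictMono g).injective.eq_iff

theorem act_inv_eq_iff {x y : I} {g : ThompsonF n} : act x g⁻¹ = y ↔ x = act y g := by
  rw [← act_inj (g := g), act_inv_act]

theorem act_inv_lt {x y : I} {g : ThompsonF n} : act x g⁻¹ < y ↔ x < act y g := by
  rw [← act_lt_act (g := g), act_inv_act]

theorem lt_act_inv {x y : I} {g : ThompsonF n} : x < act y g⁻¹ ↔ act x g < y := by
  rw [← act_lt_act (g := g), act_inv_act]

@[simp] theorem act_zero (g : ThompsonF n) : act 0 g = 0 := g.1.unop.map_bot

@[simp] theorem act_top (g : ThompsonF n) : act 1 g = 1 := g.1.unop.map_top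

theorem act_pos {x : I} (hx : 0 < x) (g : ThompsonF n) : 0 < act x g := by
  have := act_lt_act (g := g).2 hx
  rwa [act_zero] at this

theorem act_iterate_const {x : I} {g : ThompsonF n} (h : act x g = x) (k : ℤ) :
    act x (g ^ k) = x := by
  have hinv : act x g⁻¹ = x := act_inv_eq_iff.2 h.symm
  obtain ⟨i, rfl | rfl⟩ := k.eq_nat_or_neg
  · induction i with
    | zero => simp
    | succ i ih => rw [Nat.cast_succ, zpow_add, act_mul, ih, zpow_one, h]
  · induction i with
    | zero => simp
    | succ i ih => rw [Nat.cast_succ, neg_add, zpow_add, act_mul, ih, zpow_neg_one, hinv]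

/-- `g` is the linear map of slope `n ^ k` near `0`. -/
def GermAt (g : ThompsonF n) (k : ℤ) : Prop :=
  ∃ δ : I, 0 < δ ∧ ∀ z : I, z ≤ δ → (act z g : ℝ) = (n : ℝ) ^ k * z

theorem exists_germ (g : ThompsonF n) : ∃ k : ℤ, GermAt g k := by
  classical
  obtain ⟨B, -, haff⟩ := g.2
  have hne : (insert 1 (B.filter (0 < ·))).Nonempty := Finset.insert_nonempty _ _
  set y := (insert 1 (B.filter (0 < ·))).min' hne with hy
  have hy0 : 0 < y := by
    have := Finset.min'_mem _ hne
    rw [← hy, Finset.mem_insert, Finset.mem_filter] at this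
    rcases this with h | h
    · rw [h]; exact zero_lt_one
    · exact h.2
  obtain ⟨k, hk⟩ := haff 0 y hy0 (by
    rintro b hb ⟨h1, h2⟩
    exact absurd h2 (not_lt.2 (Finset.min'_le _ _ (Finset.mem_insert_of_mem
      (Finset.mem_filter.2 ⟨hb, h1⟩)))))
  refine ⟨k, y, hy0, fun z hz => ?_⟩
  have := hk z bot_le hz
  have h0 : g.1.unop 0 = 0 := act_zero g
  rw [h0] at this
  exact (this.trans (by simp) : (g.1.unop z : ℝ) = (n : ℝ) ^ k * z)

theorem GermAt.slopeAt {g : ThompsonF n} {k : ℤ} (h : GermAt g k) : slopeAt g 0 = (n : ℝ) ^ k := by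
  obtain ⟨δ, hδ, h⟩ := h
  have h1 : HasDerivWithinAt (fun y : ℝ => (n : ℝ) ^ k * y) ((n : ℝ) ^ k) (Icc 0 1) 0 := by
    simpa using ((hasDerivAt_id (0 : ℝ)).const_mul ((n : ℝ) ^ k)).hasDerivWithinAt
  have h2 : HasDerivWithinAt (fun y : ℝ => (act (projIcc 0 1 zero_le_one y) g : ℝ)) ((n : ℝ) ^ k)
      (Icc 0 1) 0 := by
    refine h1.congr_of_eventuallyEq ?_ ?_
    · have : Iio (δ : ℝ) ∈ 𝓝[Icc 0 1] (0 : ℝ) := mem_nhdsWithin_of_mem_nhds (Iio_mem_nhds hδ)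
      filter_upwards [this, self_mem_nhdsWithin] with y hy1 hy2
      rw [projIcc_of_mem zero_le_one hy2]
      exact h ⟨y, hy2⟩ (le_of_lt hy1)
    · rw [projIcc_left]
      simp
  have := h2.derivWithin (uniqueDiffOn_Icc zero_lt_one 0 (left_mem_Icc.2 zero_le_one))
  simpa [ThompsonHyp.slopeAt] using this

theorem GermAt.chi0 {g : ThompsonF n} {k : ℤ} (h : GermAt g k) : chi0 g = k := by
  have hn := two_le_cast n
  rw [ThompsonHyp.chi0, h.slopeAt, ← Real.rpow_intCast, Real.logb_rpow (by linarith) (by linarith)]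

/-- The exponent of the slope at `0`. -/
def chi (g : ThompsonF n) : ℤ := (exists_germ g).choose

theorem germAt_chi (g : ThompsonF n) : GermAt g (chi g) := (exists_germ g).choose_spec

theorem chi0_eq (g : ThompsonF n) : chi0 g = chi g := (germAt_chi g).chi0

theorem GermAt.chi_eq {g : ThompsonF n} {k : ℤ} (h : GermAt g k) : chi g = k := by
  have := h.chi0
  rw [chi0_eq] at this
  exact_mod_cast this

theorem chi_mul (g h : ThompsonF n) : chi (g * h) = chi g + chi h := by
  have hn : (n : ℝ) ≠ 0 := by linarith [two_le_cast n]
  obtain ⟨δ, hδ, hg⟩ := germAt_chi g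
  obtain ⟨ε, hε, hh⟩ := germAt_chi h
  refine GermAt.chi_eq ⟨min δ (act ε g⁻¹), lt_min hδ (act_pos hε _), fun z hz => ?_⟩
  have h1 := hg z (hz.trans (min_le_left _ _))
  have h2 : act z g ≤ ε := by
    have := act_le_act (g := g).2 (hz.trans (min_le_right _ _))
    rwa [act_inv_act] at this
  rw [act_mul, hh _ h2, h1, zpow_add₀ hn]
  ring

/-- The character `χ₀` with its integer values. -/
def chiHom : ThompsonF n →* Multiplicative ℤ where
  toFun g := Multiplicative.ofAdd (chi g)
  map_one' := by
    have := chi_mul (1 : ThompsonF n) 1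
    rw [mul_one] at this
    have h : chi (1 : ThompsonF n) = 0 := by omega
    rw [h]; rfl
  map_mul' g h := by rw [chi_mul]; rfl

theorem chi_one : chi (1 : ThompsonF n) = 0 := chiHom.map_one

theorem chi_inv (g : ThompsonF n) : chi g⁻¹ = -chi g := chiHom.map_inv g

theorem chi_zpow (g : ThompsonF n) (k : ℤ) : chi (g ^ k) = k * chi g := by
  have : chi (g ^ k) = k • chi g := map_zpow (chiHom (n := n)) g k
  simpa using this

theorem chi_of_mem_commutator {g : ThompsonF n} (hg : g ∈ commutator (ThompsonF n)) :
    chi g = 0 :=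
  Abelianization.commutator_subset_ker chiHom hg

theorem fix_near_zero {g : ThompsonF n} (hg : chi g = 0) :
    ∃ δ : I, 0 < δ ∧ ∀ z : I, z ≤ δ → act z g = z := by
  obtain ⟨δ, hδ, h⟩ := germAt_chi g
  refine ⟨δ, hδ, fun z hz => ?_⟩
  have := h z hz
  rw [hg, zpow_zero, one_mul] at this
  exact Subtype.ext this

-- Elements of F_n and of its derived subgroup with prescribed supports.

theorem exists_orderIso {f : ℝ → ℝ} (hf : StrictMono f) (hc : Continuous f) (h0 : f 0 = 0)
    (h1 : f 1 = 1) : ∃ e : I ≃o I, ∀ x, (e x : ℝ) = f x := by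
  have hmaps : ∀ x : I, f x ∈ Icc (0 : ℝ) 1 := fun x =>
    ⟨h0 ▸ hf.monotone x.2.1, h1 ▸ hf.monotone x.2.2⟩
  let F : I → I := fun x => ⟨f x, hmaps x⟩
  have hF : StrictMono F := fun x y hxy => hf hxy
  have hs : Function.Surjective F := by
    intro y
    have := intermediate_value_Icc zero_le_one hc.continuousOn
    rw [h0, h1] at this
    obtain ⟨x, hx, hxy⟩ := this y.2
    exact ⟨⟨x, hx⟩, Subtype.ext hxy⟩
  exact ⟨hF.orderIsoOfSurjective F hs, fun x => rfl⟩

/-- An element of `F_n` with support `(u, u + (n + 1) ε)`. -/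
theorem exists_bump {u ε : ℝ} (hu : IsNAdic n u) (hε : IsNAdic n ε) (hu0 : 0 ≤ u) (hε0 : 0 < ε)
    (hw : u + (n + 1) * ε ≤ 1) : ∃ g : ThompsonF n,
      (∀ x : I, (x : ℝ) ≤ u → act x g = x) ∧
      (∀ x : I, u + (n + 1) * ε ≤ x → act x g = x) ∧
      (∀ x : I, u < x → (x : ℝ) < u + (n + 1) * ε → x < act x g) ∧
      (∀ x : I, u ≤ x → (x : ℝ) ≤ u + ε → (act x g : ℝ) = u + n * (x - u)) := by
  have hn := two_le_cast n
  have hn0 : (0 : ℝ) < n := by linarith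
  have hninv : (0 : ℝ) < (n : ℝ)⁻¹ := inv_pos.2 hn0
  have hnn : (n : ℝ) * (n : ℝ)⁻¹ = 1 := mul_inv_cancel₀ hn0.ne'
  have hnε : 0 < n * ε := mul_pos hn0 hε0
  -- Slope n on an interval of length ε, then slope 1/n on one of length nε, which returns to the
  -- diagonal. The max-min formula gives continuity and monotonicity at once.
  set f : ℝ → ℝ := fun x =>
    max x (min (u + n * (x - u)) (u + n * ε + (n : ℝ)⁻¹ * (x - u - ε))) with hf
  have f1 : ∀ x, x ≤ u → f x = x := fun x hx => by
    refine max_eq_left ((min_le_left _ _).trans ?_)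
    nlinarith
  have f2 : ∀ x, u ≤ x → x ≤ u + ε → f x = u + n * (x - u) := fun x h1 h2 => by
    have e1 : u + n * (x - u) ≤ u + n * ε + (n : ℝ)⁻¹ * (x - u - ε) := by
      have : (n : ℝ)⁻¹ ≤ n := by nlinarith
      nlinarith
    simp only [hf]
    rw [min_eq_left e1, max_eq_right]
    nlinarith
  have f3 : ∀ x, u + ε ≤ x → x ≤ u + (n + 1) * ε →
      f x = u + n * ε + (n : ℝ)⁻¹ * (x - u - ε) := fun x h1 h2 => by
    have e1 : u + n * ε + (n : ℝ)⁻¹ * (x - u - ε) ≤ u + n * (x - u) := by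
      have : (n : ℝ)⁻¹ ≤ n := by nlinarith
      nlinarith
    simp only [hf]
    rw [min_eq_right e1, max_eq_right]
    have : (n : ℝ) * (x - u - n * ε) ≤ x - u - ε := by nlinarith
    have := mul_le_mul_of_nonneg_left this hninv.le
    rw [← mul_assoc, mul_comm (n : ℝ)⁻¹, hnn] at this
    linarith
  have f4 : ∀ x, u + (n + 1) * ε ≤ x → f x = x := fun x h1 => by
    refine max_eq_left ((min_le_right _ _).trans ?_)
    have : x - u - ε ≤ (n : ℝ) * (x - u - n * ε) := by nlinarith
    have := mul_le_mul_of_nonneg_left this hninv.le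
    rw [← mul_assoc, mul_comm (n : ℝ)⁻¹ n, hnn] at this
    linarith
  have hmono : StrictMono f := by
    intro x y hxy
    simp only [hf]
    refine max_lt_max hxy (min_lt_min ?_ ?_)
    · nlinarith
    · have := mul_lt_mul_of_pos_left hxy hninv
      linarith
  have hcont : Continuous f := by fun_prop
  obtain ⟨e, he⟩ := exists_orderIso hmono hcont (f1 0 hu0) (f4 1 hw)
  have hε1 : u + ε ≤ u + (n + 1) * ε := by nlinarith
  have hw' : IsNAdic n (u + (n + 1) * ε) := by
    have := (hu.add (hε.zpow_mul 1)).add hε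
    rw [zpow_one] at this
    convert this using 1; ring
  have hPL : IsPL n e := by
    refine ⟨{⟨u, hu0, by nlinarith⟩, ⟨u + ε, by linarith, by linarith⟩,
      ⟨u + (n + 1) * ε, by nlinarith, hw⟩}, ?_, ?_⟩
    · intro b hb
      simp only [Finset.mem_insert, Finset.mem_singleton] at hb
      rcases hb with rfl | rfl | rfl
      exacts [hu, hu.add hε, hw']
    · intro x y hxy hB
      simp only [Finset.mem_insert, Finset.mem_singleton, forall_eq_or_imp, forall_eq] at hB
      obtain ⟨hB1, hB2, hB3⟩ := hB
      simp only [← Subtype.coe_lt_coe] at hxy hB1 hB2 hB3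
      simp only [not_and, not_lt] at hB1 hB2 hB3
      simp only [he]
      rcases lt_or_ge (x : ℝ) u with h | h
      · refine ⟨0, fun z h1 h2 => ?_⟩
        have := hB1 h
        rw [← Subtype.coe_le_coe] at h1 h2
        rw [f1 _ (by linarith), f1 _ (by linarith)]
        simp
      rcases lt_or_ge (x : ℝ) (u + ε) with h' | h'
      · refine ⟨1, fun z h1 h2 => ?_⟩
        have := hB2 h'
        rw [← Subtype.coe_le_coe] at h1 h2
        rw [f2 z (by linarith) (by linarith), f2 x (by linarith) (by linarith), zpow_one]
        ring
      rcases lt_or_ge (x : ℝ) (u + (n + 1) * ε) with h'' | h''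
      · refine ⟨-1, fun z h1 h2 => ?_⟩
        have := hB3 h''
        rw [← Subtype.coe_le_coe] at h1 h2
        rw [f3 z (by linarith) (by linarith), f3 x (by linarith) (by linarith), zpow_neg_one]
        ring
      · refine ⟨0, fun z h1 h2 => ?_⟩
        rw [← Subtype.coe_le_coe] at h1 h2
        rw [f4 z (by linarith), f4 x (by linarith)]
        simp
  refine ⟨⟨MulOpposite.op e, hPL⟩, fun x hx => Subtype.ext ((he x).trans (f1 x hx)),
    fun x hx => Subtype.ext ((he x).trans (f4 x hx)), fun x h1 h2 => ?_,
    fun x h1 h2 => (he x).trans (f2 x h1 h2)⟩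
  rw [← Subtype.coe_lt_coe]
  refine lt_of_lt_of_eq ?_ (he x).symm
  rcases le_total (x : ℝ) (u + ε) with h | h
  · rw [f2 x h1.le h]; nlinarith
  · rw [f3 x h h2.le]
    have : (n : ℝ) * (x - u - n * ε) < x - u - ε := by nlinarith
    have := mul_lt_mul_of_pos_left this hninv
    rw [← mul_assoc, mul_comm (n : ℝ)⁻¹ n, hnn] at this
    linarith

theorem exists_nAdic (n : ℕ) [n.AtLeastTwo] {s t : ℝ} (h : s < t) :
    ∃ x, IsNAdic n x ∧ s < x ∧ x < t := by
  have hn := two_le_cast n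
  obtain ⟨k, hk⟩ := pow_unbounded_of_one_lt (t - s)⁻¹ (show (1 : ℝ) < n by linarith)
  have hp : (0 : ℝ) < (n : ℝ) ^ k := by positivity
  have h1 : 1 < (n : ℝ) ^ k * (t - s) := by
    have := mul_lt_mul_of_pos_right hk (sub_pos.2 h)
    rwa [inv_mul_cancel₀ (sub_pos.2 h).ne'] at this
  refine ⟨(⌊s * (n : ℝ) ^ k⌋ + 1 : ℤ) / (n : ℝ) ^ k, ⟨_, k, rfl⟩, ?_, ?_⟩
  · rw [lt_div_iff₀ hp]; push_cast; exact Int.lt_floor_add_one _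
  · rw [div_lt_iff₀ hp]; push_cast
    have := Int.floor_le (s * (n : ℝ) ^ k)
    nlinarith

/-- Otherwise the supremum of the orbit of `p` would be a point of (u, v) that `g` does not move
upwards. -/
theorem exists_pow_gt {g : ThompsonF n} {u v : I} (h : ∀ x, u < x → x < v → x < act x g)
    {p q : I} (hp : u < p) (hq : q < v) : ∃ k : ℕ, q < act p (g ^ k) := by
  by_contra! H
  set s : I := ⨆ k : ℕ, act p (g ^ k) with hs
  have hps : p ≤ s := le_iSup (fun k : ℕ => act p (g ^ k)) 0
  have hsq : s ≤ q := iSup_le H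
  have h1 := h s (hp.trans_le hps) (hsq.trans_lt hq)
  have h2 : act s g = ⨆ k : ℕ, act (act p (g ^ k)) g := g.1.unop.map_iSup _
  have h3 : act s g ≤ s := by
    rw [h2]
    refine iSup_le fun k => ?_
    rw [← act_mul, ← pow_succ]
    exact le_iSup (fun k : ℕ => act p (g ^ k)) (k + 1)
  exact absurd h1 (not_lt.2 h3)

theorem exists_push (n : ℕ) [n.AtLeastTwo] {u p q v : I} (hup : u < p) (hqv : q < v)
    (hpq : p < q) : ∃ g : ThompsonF n,
    (∀ x, x ≤ u → act x g = x) ∧ (∀ x, v ≤ x → act x g = x) ∧ q < act p g := by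
  have hn := two_le_cast n
  have hn1 : (0 : ℝ) < n + 1 := by linarith
  rw [← Subtype.coe_lt_coe] at hup hqv hpq
  obtain ⟨u', hu', hu1, hu2⟩ := exists_nAdic n hup
  have : ((q : ℝ) - u') / (n + 1) < (v - u') / (n + 1) :=
    div_lt_div_of_pos_right (by linarith) hn1
  obtain ⟨ε, hε, he1, he2⟩ := exists_nAdic n this
  rw [div_lt_iff₀ hn1] at he1
  rw [lt_div_iff₀ hn1] at he2
  have hu0 := u.2.1
  have hv1 := v.2.2
  have hε0 : 0 < ε := by
    by_contra! hneg
    nlinarith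
  obtain ⟨g, h1, h2, h3, -⟩ := exists_bump hu' hε (by linarith) hε0 (by linarith)
  let w : I := ⟨u' + (n + 1) * ε, by nlinarith, by linarith⟩
  let u₁ : I := ⟨u', by linarith, by linarith [p.2.2]⟩
  obtain ⟨k, hk⟩ := exists_pow_gt (g := g) (u := u₁) (v := w) (p := p) (q := q)
    (fun x hx hxw => h3 x hx hxw) hu2 (by rw [← Subtype.coe_lt_coe]; simp only [w]; linarith)
  refine ⟨g ^ k, fun x hx => ?_, fun x hx => ?_, hk⟩
  · rw [← Subtype.coe_le_coe] at hx
    simpa using act_iterate_const (h1 x (by linarith)) k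
  · rw [← Subtype.coe_le_coe] at hx
    simpa using act_iterate_const (h2 x (by linarith)) k

theorem exists_push_commutator (n : ℕ) [n.AtLeastTwo] {u p q v : I} (hup : u < p) (hqv : q < v)
    (hpq : p < q) : ∃ g ∈ commutator (ThompsonF n),
    (∀ x, x ≤ u → act x g = x) ∧ (∀ x, v ≤ x → act x g = x) ∧ q < act p g := by
  obtain ⟨u', h1, h2⟩ := exists_between hup
  obtain ⟨v', h3, h4⟩ := exists_between hqv
  obtain ⟨b, hb1, hb2, hb3⟩ := exists_push n h2 h3 hpq
  obtain ⟨c, hc1, hc2, hc3⟩ := exists_push n h1 h4 (h2.trans (hpq.trans h3))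
  have binv : ∀ x, act x b = x → act x b⁻¹ = x := fun x hx => act_inv_eq_iff.2 hx.symm
  have cinv : ∀ x, act x c = x → act x c⁻¹ = x := fun x hx => act_inv_eq_iff.2 hx.symm
  -- In b c⁻¹ b⁻¹ c, the factor c⁻¹ throws p.b to the left of the support of b, so that b⁻¹ does
  -- nothing and c undoes c⁻¹; the point p moves as under b.
  refine ⟨⁅b, c⁻¹⁆, ?_, fun x hx => ?_, fun x hx => ?_, ?_⟩
  · rw [commutator_def]
    exact Subgroup.commutator_mem_commutator (Subgroup.mem_top _) (Subgroup.mem_top _)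
  · rw [commutatorElement_def, inv_inv, act_mul, act_mul, act_mul, hb1 x (hx.trans h1.le),
      cinv x (hc1 x hx), binv x (hb1 x (hx.trans h1.le)), hc1 x hx]
  · rw [commutatorElement_def, inv_inv, act_mul, act_mul, act_mul, hb2 x (h4.le.trans hx),
      cinv x (hc2 x hx), binv x (hb2 x (h4.le.trans hx)), hc2 x hx]
  · rw [commutatorElement_def, inv_inv, act_mul, act_mul, act_mul]
    have h5 : act p b < v' := by
      rw [← hb2 v' le_rfl, act_lt_act]
      exact hpq.trans h3
    have h6 : act (act p b) c⁻¹ ≤ u' := (act_inv_lt.2 (h5.trans hc3)).le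
    rw [binv _ (hb1 _ h6), act_inv_act]
    exact hb3

-- The sets Q_S are contracting.

theorem thompson_ext {g h : ThompsonF n} (H : ∀ x, act x g = act x h) : g = h :=
  Subtype.ext (MulOpposite.unop_injective (OrderIso.ext (funext H)))

/-- `a` expands the interval `(0, r)`, which is its support, and has slope `n` at `0`. -/
structure IsExpanding (a : ThompsonF n) (r : I) : Prop where
  chi_eq : chi a = 1
  support : {x | act x a ≠ x} = Ioo 0 r
  lt_one : r < 1

/-- The special sequences of a splitting, which depend on `a` and `r` only. -/
structure IsSpecialSeq (a : ThompsonF n) (r : I) (τ : ℕ → I) : Prop where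
  zero : τ 0 = r
  pos : ∀ j, 0 < τ j
  anti : StrictAnti τ
  double : ∀ j, 1 ≤ j → act (τ j) a⁻¹ = τ (2 * j)

/-- `g` and `g⁻¹` keep the points `τ_s`, `s ∈ S̃`, between their neighbours. -/
def Pinned (τ : ℕ → I) (S : Set ℕ) (g : ThompsonF n) : Prop :=
  ∀ s, Tilde S s →
    act (τ s) g ∈ Ioo (τ (s + 1)) (τ (s - 1)) ∧ act (τ s) g⁻¹ ∈ Ioo (τ (s + 1)) (τ (s - 1))

/-- The variant of `Q_S` in the kernel of `χ₀` instead of the derived subgroup. -/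
def pinnedKer (τ : ℕ → I) (S : Set ℕ) : Set (ThompsonF n) := {g | chi g = 0 ∧ Pinned τ S g}

/-- The elements that fix `[0, r]` pointwise. -/
def fixing (n : ℕ) [n.AtLeastTwo] (r : I) : Subgroup (ThompsonF n) where
  carrier := {g | ∀ x ≤ r, act x g = x}
  one_mem' := fun _ _ => rfl
  mul_mem' := fun {g h} hg hh x hx => by rw [act_mul, hg x hx, hh x hx]
  inv_mem' := fun {_} hg x hx => act_inv_eq_iff.2 (hg x hx).symm

theorem chi_of_mem_fixing {r : I} (hr : 0 < r) {g : ThompsonF n} (hg : g ∈ fixing n r) :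
    chi g = 0 :=
  GermAt.chi_eq ⟨r, hr, fun z hz => by rw [hg z hz, zpow_zero, one_mul]⟩

theorem Tilde.mono {S R : Set ℕ} (h : S ⊆ R) {s : ℕ} (hs : Tilde S s) : Tilde R s := by
  induction hs with
  | base s hs => exact .base s (h hs)
  | double s _ ih => exact .double s ih
  | succ s _ ih => exact .succ s ih
  | pred s _ ih => exact .pred s ih

theorem Tilde.pow_mul {S : Set ℕ} {s : ℕ} (hs : Tilde S s) (k : ℕ) : Tilde S (2 ^ k * s) := by
  induction k with
  | zero => simpa using hs
  | succ k ih => rw [pow_succ', mul_assoc]; exact .double _ ih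

theorem Tilde.ge {S : Set ℕ} {m : ℕ} (hm : 1 ≤ m) (hS : ∀ s ∈ S, m ≤ s) {s : ℕ}
    (hs : Tilde S s) : m ≤ s := by
  induction hs with
  | base s hs => exact hS s hs
  | double s _ ih => omega
  | succ s _ ih => omega
  | pred s _ ih => omega

theorem Tilde.pos {S : Set ℕ} (hS : ∀ s ∈ S, Odd s) {s : ℕ} (hs : Tilde S s) : 1 ≤ s :=
  hs.ge le_rfl fun s hs => (hS s hs).pos

theorem Pinned.inv {τ : ℕ → I} {S : Set ℕ} {g : ThompsonF n} (hg : Pinned τ S g) :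
    Pinned τ S g⁻¹ := fun s hs => by
  rw [inv_inv]
  exact (hg s hs).symm

theorem Pinned.mono {τ : ℕ → I} {S R : Set ℕ} (h : S ⊆ R) {g : ThompsonF n}
    (hg : Pinned τ R g) : Pinned τ S g := fun s hs => hg s (hs.mono h)

namespace IsExpanding

variable {a : ThompsonF n} {r : I}

theorem act_of_ge (ha : IsExpanding a r) {x : I} (hx : r ≤ x) : act x a = x := by
  by_contra h
  have : x ∈ Ioo 0 r := ha.support ▸ h
  exact absurd this.2 (not_lt.2 hx)

theorem lt_act_small (ha : IsExpanding a r) :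
    ∃ δ : I, 0 < δ ∧ ∀ x, 0 < x → x ≤ δ → x < act x a := by
  obtain ⟨δ, hδ, h⟩ := germAt_chi a
  refine ⟨δ, hδ, fun x hx0 hx => ?_⟩
  have h1 := h x hx
  have := two_le_cast n
  rw [ha.chi_eq, zpow_one] at h1
  rw [← Subtype.coe_lt_coe, h1]
  have : (0 : ℝ) < x := hx0
  nlinarith

theorem r_pos (ha : IsExpanding a r) : 0 < r := by
  obtain ⟨δ, hδ, h⟩ := ha.lt_act_small
  have : δ ∈ {x | act x a ≠ x} := (h δ hδ le_rfl).ne'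
  rw [ha.support] at this
  exact this.1.trans this.2

/-- Since `a` moves points up near 0, a point moved down would have an orbit decreasing to a fixed
point inside the support. -/
theorem lt_act (ha : IsExpanding a r) {x : I} (h0 : 0 < x) (hr : x < r) : x < act x a := by
  by_contra! hle
  obtain ⟨δ, hδ, hsmall⟩ := ha.lt_act_small
  set y := min δ x with hy
  have hy0 : 0 < y := lt_min hδ h0
  have hya : y < act y a := hsmall y hy0 (min_le_left _ _)
  have hlow : ∀ k : ℕ, y ≤ act x (a ^ k) := by
    intro k
    induction k with
    | zero => simp [hy]
    | succ k ih => rw [pow_succ, act_mul]; exact hya.le.trans (act_le_act.2 ih)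
  have hdec : ∀ k : ℕ, act x (a ^ (k + 1)) ≤ act x (a ^ k) := by
    intro k
    rw [pow_succ', act_mul]
    exact act_le_act.2 hle
  set s : I := ⨅ k : ℕ, act x (a ^ k) with hs
  have h1 : y ≤ s := le_iInf hlow
  have h2 : s ≤ x := iInf_le (fun k : ℕ => act x (a ^ k)) 0
  have h3 : act s a = ⨅ k : ℕ, act (act x (a ^ k)) a := a.1.unop.map_iInf _
  have h4 : act s a = s := by
    rw [h3]
    simp only [← act_mul, ← pow_succ]
    apply le_antisymm
    · exact le_iInf fun k => (iInf_le (fun k : ℕ => act x (a ^ (k + 1))) k).trans (hdec k)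
    · exact le_iInf fun k => iInf_le (fun k : ℕ => act x (a ^ k)) (k + 1)
  have h5 : s ∈ {x | act x a ≠ x} := by
    rw [ha.support]
    exact ⟨hy0.trans_le h1, h2.trans_lt hr⟩
  exact h5 h4

theorem comm_fixing (ha : IsExpanding a r) {p : ThompsonF n} (hp : p ∈ fixing n r) :
    a * p = p * a := by
  refine thompson_ext fun x => ?_
  rw [act_mul, act_mul]
  rcases le_total x r with h | h
  · rw [hp x h, hp]
    rw [← ha.act_of_ge (x := r) le_rfl]
    exact act_le_act.2 h
  · rw [ha.act_of_ge h, ha.act_of_ge]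
    rw [← hp r le_rfl]
    exact act_le_act.2 h

end IsExpanding

namespace IsSpecialSeq

variable {a : ThompsonF n} {r : I} {τ : ℕ → I} {S : Set ℕ}

theorem lt_r (hτ : IsSpecialSeq a r τ) {j : ℕ} (hj : 1 ≤ j) : τ j < r :=
  hτ.zero ▸ hτ.anti hj

theorem le_r (hτ : IsSpecialSeq a r τ) (j : ℕ) : τ j ≤ r :=
  hτ.zero ▸ hτ.anti.antitone (Nat.zero_le j)

theorem act_pow_inv (ha : IsExpanding a r) (hτ : IsSpecialSeq a r τ) (k s : ℕ) :
    act (τ s) (a ^ k)⁻¹ = τ (2 ^ k * s) := by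
  -- The convention τ_0 = r is compatible with doubling because `a` fixes r; the index 0 does occur,
  -- as `s - 1` for `s = 1`.
  rcases Nat.eq_zero_or_pos s with rfl | hs
  · rw [mul_zero, hτ.zero, act_inv_eq_iff]
    simpa using (act_iterate_const (ha.act_of_ge (x := r) le_rfl) k).symm
  · induction k with
    | zero => simp
    | succ k ih =>
      rw [pow_succ', mul_inv_rev, act_mul, ih, hτ.double _ (Nat.mul_pos (by positivity) hs),
        pow_succ', mul_assoc]

theorem act_pow (ha : IsExpanding a r) (hτ : IsSpecialSeq a r τ) (k s : ℕ) :
    act (τ (2 ^ k * s)) (a ^ k) = τ s := by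
  rw [← hτ.act_pow_inv ha, act_inv_act]

theorem exists_lt (ha : IsExpanding a r) (hτ : IsSpecialSeq a r τ) {x : I} (hx : 0 < x) :
    ∃ j, 1 ≤ j ∧ τ j < x := by
  rcases le_or_gt r x with h | h
  · exact ⟨1, le_rfl, (hτ.lt_r le_rfl).trans_le h⟩
  · obtain ⟨k, hk⟩ := exists_pow_gt (g := a) (fun x h0 hr => ha.lt_act h0 hr) hx (hτ.lt_r le_rfl)
    refine ⟨2 ^ k * 1, by simp [Nat.one_le_two_pow], ?_⟩
    rw [← hτ.act_pow_inv ha]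
    exact act_inv_lt.2 hk

/-- A conjugate by an element that is a positive power of `a` on `[0, r]`. -/
theorem pinned_conj (ha : IsExpanding a r) (hτ : IsSpecialSeq a r τ) {k : ℕ} {p : ThompsonF n}
    (hp : p ∈ fixing n r) {g : ThompsonF n}
    (h : ∀ s, Tilde S s →
      act (τ (2 ^ k * s)) g ∈ Ioo (τ (2 ^ k * (s + 1))) (τ (2 ^ k * (s - 1))) ∧
      act (τ (2 ^ k * s)) g⁻¹ ∈ Ioo (τ (2 ^ k * (s + 1))) (τ (2 ^ k * (s - 1)))) :
    Pinned τ S ((a ^ k * p)⁻¹ * g * (a ^ k * p)) := by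
  have key : ∀ (s : ℕ) (g : ThompsonF n),
      act (τ (2 ^ k * s)) g ∈ Ioo (τ (2 ^ k * (s + 1))) (τ (2 ^ k * (s - 1))) →
      act (τ s) ((a ^ k * p)⁻¹ * g * (a ^ k * p)) ∈ Ioo (τ (s + 1)) (τ (s - 1)) := by
    rintro s g ⟨h1, h2⟩
    rw [mul_inv_rev, act_mul, act_mul, act_mul, act_mul, (inv_mem hp : p⁻¹ ∈ fixing n r) _ (hτ.le_r s),
      hτ.act_pow_inv ha]
    have h3 := act_lt_act (g := a ^ k).2 h1
    have h4 := act_lt_act (g := a ^ k).2 h2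
    rw [hτ.act_pow ha] at h3 h4
    rw [hp _ (h4.le.trans (hτ.le_r _))]
    exact ⟨h3, h4⟩
  intro s hs
  refine ⟨key s g (h s hs).1, ?_⟩
  have := key s g⁻¹ (h s hs).2
  convert this using 2
  group

theorem pinned_stay (ha : IsExpanding a r) (hτ : IsSpecialSeq a r τ) (hS : ∀ s ∈ S, Odd s)
    {k : ℕ} {p : ThompsonF n} (hp : p ∈ fixing n r) {g : ThompsonF n} (hg : Pinned τ S g) :
    Pinned τ S ((a ^ k * p)⁻¹ * g * (a ^ k * p)) := by
  refine hτ.pinned_conj ha hp fun s hs => ?_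
  have h1 := hs.pos hS
  have h2 : 1 ≤ 2 ^ k := Nat.one_le_two_pow
  have h3 : 2 ^ k * s + 1 ≤ 2 ^ k * (s + 1) := by rw [mul_add, mul_one]; omega
  have h4 : 2 ^ k * (s - 1) ≤ 2 ^ k * s - 1 := by
    rw [Nat.mul_sub, mul_one]; omega
  have h5 := Ioo_subset_Ioo (hτ.anti.antitone h3) (hτ.anti.antitone h4)
  have := hg _ (hs.pow_mul k)
  exact ⟨h5 this.1, h5 this.2⟩

/-- The first factor moves τ_(32s) by less than one index; since 32s ± 1 ∈ S̃, the second keeps the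
result strictly within two indices. After conjugation by a^5 this is less than one index at τ_s. -/
theorem pinned_mul (ha : IsExpanding a r) (hτ : IsSpecialSeq a r τ) (hS : ∀ s ∈ S, Odd s)
    {g h : ThompsonF n} (hg : Pinned τ S g) (hh : Pinned τ S h) :
    Pinned τ S ((a ^ 5)⁻¹ * (g * h) * a ^ 5) := by
  have key : ∀ g h : ThompsonF n, Pinned τ S g → Pinned τ S h → ∀ s, Tilde S s →
      act (τ (2 ^ 5 * s)) (g * h) ∈ Ioo (τ (2 ^ 5 * (s + 1))) (τ (2 ^ 5 * (s - 1))) := by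
    intro g h hg hh s hs
    have h1 := hs.pos hS
    rw [act_mul]
    have e := (hg _ (hs.pow_mul 5)).1
    have e1 := (hh _ hs.succ).1.1
    have e2 := (hh _ hs.pred).1.2
    exact ⟨(hτ.anti.antitone (by omega)).trans_lt (e1.trans (act_lt_act.2 e.1)),
      ((act_lt_act.2 e.2).trans e2).trans_le (hτ.anti.antitone (by omega))⟩
  have := hτ.pinned_conj ha (k := 5) (one_mem (fixing n r)) (g := g * h) fun s hs =>
    ⟨key g h hg hh s hs, by rw [mul_inv_rev]; exact key _ _ hh.inv hg.inv s hs⟩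
  simpa using this

/-- An element of slope 1 at 0 is trivial near 0, and a high power of a⁻¹ brings all τ_s with s ≥ 1
into that neighbourhood. -/
theorem pinned_get (ha : IsExpanding a r) (hτ : IsSpecialSeq a r τ) (hS : ∀ s ∈ S, Odd s)
    {g : ThompsonF n} (hg : chi g = 0) : ∃ k : ℕ, Pinned τ S ((a ^ k)⁻¹ * g * a ^ k) := by
  obtain ⟨δ, hδ, hfix⟩ := fix_near_zero hg
  obtain ⟨j, hj, hjδ⟩ := hτ.exists_lt ha hδ
  refine ⟨j, ?_⟩
  suffices Pinned τ S ((a ^ j * 1)⁻¹ * g * (a ^ j * 1)) by simpa using this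
  refine hτ.pinned_conj ha (one_mem _) fun s hs => ?_
  have h1 := hs.pos hS
  have h2 : j ≤ 2 ^ j * s := (Nat.lt_two_pow_self.le).trans (Nat.le_mul_of_pos_right _ h1)
  have h3 := hfix _ ((hτ.anti.antitone h2).trans hjδ.le)
  rw [h3, act_inv_eq_iff.2 h3.symm]
  have hp : 0 < 2 ^ j := by positivity
  have h4 : τ (2 ^ j * s) ∈ Ioo (τ (2 ^ j * (s + 1))) (τ (2 ^ j * (s - 1))) :=
    ⟨hτ.anti (Nat.mul_lt_mul_of_pos_left (by omega) hp),
      hτ.anti (Nat.mul_lt_mul_of_pos_left (by omega) hp)⟩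
  exact ⟨h4, h4⟩

theorem pinned_of_fix (hτ : IsSpecialSeq a r τ) (hS : ∀ s ∈ S, Odd s) {g : ThompsonF n}
    (h : ∀ s, Tilde S s → act (τ s) g = τ s) : Pinned τ S g := by
  intro s hs
  have h1 := hs.pos hS
  have h2 : τ s ∈ Ioo (τ (s + 1)) (τ (s - 1)) := ⟨hτ.anti (by omega), hτ.anti (by omega)⟩
  rw [h s hs, act_inv_eq_iff.2 (h s hs).symm]
  exact ⟨h2, h2⟩

theorem pinned_fixing_mul (hτ : IsSpecialSeq a r τ) {p g : ThompsonF n} (hp : p ∈ fixing n r)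
    (hg : Pinned τ S g) : Pinned τ S (p * g) := by
  intro s hs
  obtain ⟨h1, h2⟩ := hg s hs
  rw [mul_inv_rev, act_mul, act_mul, hp _ (hτ.le_r s),
    (inv_mem hp : p⁻¹ ∈ fixing n r) _ (h2.2.le.trans (hτ.le_r _))]
  exact ⟨h1, h2⟩

theorem isContracting (ha : IsExpanding a r) (hτ : IsSpecialSeq a r τ) (hS : ∀ s ∈ S, Odd s) :
    IsContracting chi a (pinnedKer τ S) where
  map_mul := chi_mul
  map_a := ha.chi_eq
  ker := fun _ hq => hq.1
  symm := fun q hq => ⟨by rw [chi_inv, hq.1, neg_zero], hq.2.inv⟩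
  stay := fun q hq => ⟨by rw [chi_mul, chi_mul, chi_inv, hq.1]; ring, by
    simpa using hτ.pinned_stay ha hS (k := 1) (one_mem (fixing n r)) hq.2⟩
  get := fun h hh => by
    obtain ⟨k, hk⟩ := hτ.pinned_get ha hS hh
    exact ⟨k, by rw [chi_mul, chi_mul, chi_inv, hh]; ring, hk⟩
  prod := ⟨5, fun p hp q hq => ⟨by
    rw [chi_mul, chi_mul, chi_mul, chi_inv, hp.1, hq.1]; ring, hτ.pinned_mul ha hS hp.2 hq.2⟩⟩

theorem exists_not_pinned (ha : IsExpanding a r) (hτ : IsSpecialSeq a r τ) (hS : ∀ s ∈ S, Odd s)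
    -- For s = min S, an element supported to the right of τ_s fixes all pinned points, yet it may
    -- push τ_s.a past τ_(s-1).a; conjugation by a⁻¹ then violates the condition at s.
    (hne : S.Nonempty) : ∃ g ∈ commutator (ThompsonF n), Pinned τ S g ∧
      ¬ Pinned τ S (a * g * a⁻¹) := by
  obtain ⟨s, hs, hmin⟩ := WellFounded.has_min Nat.lt_wfRel.wf S hne
  have hs1 := (hS s hs).pos
  have hp : act (τ s) a < act (τ (s - 1)) a := act_lt_act.2 (hτ.anti (by omega))
  have hq : act (τ (s - 1)) a < 1 :=
    (act_le_act.2 (hτ.le_r _)).trans_lt (by rw [ha.act_of_ge le_rfl]; exact ha.lt_one)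
  obtain ⟨g, hg, hg1, -, hg3⟩ := exists_push_commutator n (ha.lt_act (hτ.pos s) (hτ.lt_r hs1)) hq hp
  refine ⟨g, hg, hτ.pinned_of_fix hS fun t ht => hg1 _ (hτ.anti.antitone ?_), fun h => ?_⟩
  · exact ht.ge hs1 fun t ht => not_lt.1 (hmin t ht)
  · have := (h s (.base s hs)).1.2
    rw [act_mul, act_mul, act_inv_lt] at this
    exact absurd this (not_lt.2 hg3.le)

/-- An element supported between τ_m and τ_(m-2) moves no member of the sequence except τ_(m-1), and
keeps that one between its neighbours, so it is pinned for every S. Such supports, and those to the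
right of τ_1, cover (0, 1). -/
theorem exists_pinned_moving (ha : IsExpanding a r) (hτ : IsSpecialSeq a r τ)
    (hS : ∀ s ∈ S, Odd s) {t : I} (h0 : 0 < t) (h1 : t < 1) :
    ∃ g ∈ commutator (ThompsonF n), Pinned τ S g ∧ act t g ≠ t := by
  rcases lt_or_ge (τ 1) t with ht | ht
  · obtain ⟨q, hq, hq1⟩ := exists_between h1
    obtain ⟨g, hg, hg1, -, hg3⟩ := exists_push_commutator n ht hq1 hq
    exact ⟨g, hg, hτ.pinned_of_fix hS fun s hs => hg1 _ (hτ.anti.antitone (hs.pos hS)),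
      (hq.trans hg3).ne'⟩
  · obtain ⟨j₀, -, hj₀⟩ := hτ.exists_lt ha h0
    classical
    have hex : ∃ j, τ j < t := ⟨j₀, hj₀⟩
    set m := Nat.find hex with hm
    have hm1 : τ m < t := Nat.find_spec hex
    have hm2 : 2 ≤ m := by
      by_contra! hlt
      exact absurd hm1 (not_lt.2 (ht.trans (hτ.anti.antitone (by omega))))
    have hm3 : t ≤ τ (m - 1) := not_lt.1 (Nat.find_min hex (by omega))
    have hm4 : t < τ (m - 2) := hm3.trans_lt (hτ.anti (by omega))
    obtain ⟨q, hq, hq1⟩ := exists_between hm4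
    obtain ⟨g, hg, hg1, hg2, hg3⟩ := exists_push_commutator n hm1 hq1 hq
    refine ⟨g, hg, ?_, (hq.trans hg3).ne'⟩
    have hfix : ∀ s, s ≠ m - 1 → act (τ s) g = τ s := by
      intro s hs
      rcases lt_or_ge s (m - 1) with h | h
      · exact hg2 _ (hτ.anti.antitone (by omega))
      · exact hg1 _ (hτ.anti.antitone (by omega))
    intro s hs
    have hs1 := hs.pos hS
    by_cases hsm : s = m - 1
    · have e1 := hfix (s + 1) (by omega)
      have e2 := hfix (s - 1) (by omega)
      have h1 : τ (s + 1) < τ s := hτ.anti (by omega)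
      have h2 : τ s < τ (s - 1) := hτ.anti (by omega)
      refine ⟨⟨?_, ?_⟩, ?_, ?_⟩
      · rw [← e1]; exact act_lt_act.2 h1
      · rw [← e2]; exact act_lt_act.2 h2
      · rw [lt_act_inv, e1]; exact h1
      · rw [act_inv_lt, e2]; exact h2
    · have h2 : τ s ∈ Ioo (τ (s + 1)) (τ (s - 1)) := ⟨hτ.anti (by omega), hτ.anti (by omega)⟩
      rw [hfix s hsm, act_inv_eq_iff.2 (hfix s hsm).symm]
      exact ⟨h2, h2⟩

end IsSpecialSeq

-- Gaps in S̃ for sparse sets, and comparison of the sets Q_S.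

theorem Tilde.near {S : Set ℕ} (hS : ∀ s ∈ S, Odd s) {t : ℕ} (ht : Tilde S t) :
    -- The bound reproduces itself under t ↦ 32t ± 1, as 32(2^p - 1)/31 + 1 = (2^(p+5) - 1)/31.
    ∃ y ∈ S, ∃ p : ℕ, |(t : ℝ) - 2 ^ p * y| ≤ (2 ^ p - 1) / 31 := by
  induction ht with
  | base s hs => exact ⟨s, hs, 0, by simp⟩
  | double s _ ih =>
    obtain ⟨y, hy, p, h⟩ := ih
    refine ⟨y, hy, p + 1, ?_⟩
    rw [abs_le] at *
    push_cast
    rw [pow_succ]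
    constructor <;> linarith
  | succ s _ ih =>
    obtain ⟨y, hy, p, h⟩ := ih
    refine ⟨y, hy, p + 5, ?_⟩
    rw [abs_le] at *
    push_cast
    rw [pow_add]
    constructor <;> linarith
  | pred s hs ih =>
    obtain ⟨y, hy, p, h⟩ := ih
    refine ⟨y, hy, p + 5, ?_⟩
    have := hs.pos hS
    rw [abs_le] at *
    rw [Nat.cast_sub (by omega)]
    push_cast
    rw [pow_add]
    constructor <;> linarith

theorem IsSparse.lt_abs {O : Set ℕ} (hO : IsSparse O) {x y : ℕ} (hx : x ∈ O) (hy : y ∈ O)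
    (hxy : x ≠ y) (p q : ℕ) : (2 : ℝ) ^ p / 8 < |(2 : ℝ) ^ q * x - 2 ^ p * y| := by
  by_contra! h
  have hq : (0 : ℝ) < 2 ^ q := by positivity
  refine hxy (hO.2 x hx y hy ((p : ℤ) - q) ?_).2
  have e : (2 : ℝ) ^ ((p : ℤ) - q) = 2 ^ p / 2 ^ q := by
    rw [zpow_sub₀ two_ne_zero, zpow_natCast, zpow_natCast]
  have e3 : (2 : ℝ) ^ ((p : ℤ) - q - 3) = 2 ^ p / 2 ^ q / 8 := by
    rw [zpow_sub₀ two_ne_zero, e]; norm_num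
  rw [e, e3]
  have e4 : (2 : ℝ) ^ q * x - 2 ^ p * y = 2 ^ q * (x - 2 ^ p / 2 ^ q * y) := by
    field_simp
  rw [e4, abs_mul, abs_of_pos hq] at h
  rw [div_div, div_eq_mul_inv]
  rw [← le_div_iff₀' hq] at h
  refine h.trans (le_of_eq ?_)
  field_simp

theorem IsSparse.tilde_gap {O : Set ℕ} (hO : IsSparse O) {R : Set ℕ} (hR : R ⊆ O) {s : ℕ}
    (hs : s ∈ O) (hsR : s ∉ R) (N : ℕ) {t : ℕ} (ht : Tilde R t) (h1 : t ≤ 2 ^ (N + 4) * s) :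
    t + 2 ^ N < 2 ^ (N + 4) * s := by
  by_contra! h2
  obtain ⟨y, hy, p, hp⟩ := ht.near fun x hx => hO.1 x (hR hx)
  have hne : s ≠ y := fun h => hsR (h ▸ hy)
  -- Let D = |2^(N+4) s - 2^p y|. Sparseness, used in both directions, gives D > 2^p/8 and D >
  -- 2·2^N, while a small gap would give D ≤ 2^N + (2^p - 1)/31 < D/2 + 8D/31 < D.
  have a1 := hO.lt_abs hs (hR hy) hne p (N + 4)
  have a2 := hO.lt_abs (hR hy) hs hne.symm (N + 4) p
  rw [abs_sub_comm] at a2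
  have h1' : (t : ℝ) ≤ 2 ^ (N + 4) * s := by exact_mod_cast h1
  have h2' : (2 : ℝ) ^ (N + 4) * s ≤ t + 2 ^ N := by exact_mod_cast h2
  have hb : |(2 : ℝ) ^ (N + 4) * s - 2 ^ p * y| ≤ 2 ^ N + (2 ^ p - 1) / 31 := by
    rw [abs_le] at *
    have : (0 : ℝ) < 2 ^ N := by positivity
    constructor <;> linarith
  have hN : (2 : ℝ) ^ (N + 4) = 16 * 2 ^ N := by rw [pow_add]; ring
  have hN0 : (0 : ℝ) < 2 ^ N := by positivity
  have hN8 : (2 : ℝ) ^ (N + 4) / 8 = 2 * 2 ^ N := by rw [hN]; ring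
  rw [hN8] at a2
  linarith

namespace IsSpecialSeq

variable {a : ThompsonF n} {r : I} {τ : ℕ → I}

theorem subset_of_conj_pinned (ha : IsExpanding a r) (hτ : IsSpecialSeq a r τ) {O S R : Set ℕ}
    (hO : IsSparse O) (hS : S ⊆ O) (hR : R ⊆ O) {N : ℕ}
    (h : ∀ g ∈ commutator (ThompsonF n), Pinned τ R g → Pinned τ S ((a ^ N)⁻¹ * g * a ^ N)) :
    S ⊆ R := by
  intro s hs
  by_contra hsR
  have hs1 := (hO.1 s (hS hs)).pos
  -- a^N carries τ_M to τ_(16s) and τ_(M - 2^N) to τ_(16s - 1), and 16s ∈ S̃. Pushing τ_M past τ_(M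
  -- - 2^N) inside the gap of R̃ thus breaks the condition at 16s.
  set M := 2 ^ (N + 4) * s with hM
  have hN : 1 ≤ 2 ^ N := Nat.one_le_two_pow
  have hMN : 2 ^ N + 1 ≤ M := by
    rw [hM, pow_add, mul_assoc]
    have : 2 ^ N * 2 ≤ 2 ^ N * (2 ^ 4 * s) := Nat.mul_le_mul_left _ (by omega)
    omega
  have h1 : τ (M + 1) < τ M := hτ.anti (by omega)
  have h2 : τ (M - 2 ^ N) < τ (M - 2 ^ N - 1) := hτ.anti (by omega)
  have h3 : τ M < τ (M - 2 ^ N) := hτ.anti (by omega)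
  obtain ⟨g, hg, hg1, hg2, hg3⟩ := exists_push_commutator n h1 h2 h3
  have hpin : Pinned τ R g := hτ.pinned_of_fix (fun x hx => hO.1 x (hR hx)) fun t ht => by
    rcases le_or_gt t M with htM | htM
    · have := hO.tilde_gap hR (hS hs) hsR N ht htM
      exact hg2 _ (hτ.anti.antitone (by omega))
    · exact hg1 _ (hτ.anti.antitone htM)
  have h4 := (h g hg hpin _ ((Tilde.base s hs).pow_mul 4)).1.2
  rw [act_mul, act_mul, hτ.act_pow_inv ha, ← mul_assoc, ← pow_add, ← hM] at h4
  have h5 := hg3.trans (lt_act_inv.2 h4)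
  rw [hτ.act_pow_inv ha, hτ.anti.lt_iff_gt, Nat.mul_sub, ← mul_assoc, ← pow_add, mul_one, ← hM] at h5
  exact lt_irrefl _ h5

theorem isAdapted (ha : IsExpanding a r) (hτ : IsSpecialSeq a r τ) {S : Set ℕ}
    {B : Set (ThompsonF n)} (hB : a ∈ B) (hbd : BoundedIn B (pinnedKer τ S))
    (hlet : ∀ x ∈ B, x ∈ pinnedKer τ S ∨ (|chi x| ≤ 1 ∧ a ^ (-chi x) * x ∈ fixing n r)) :
    IsAdapted chi a (pinnedKer τ S) (fixing n r) B where
  comm := fun _ hp => ha.comm_fixing hp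
  absorb := fun p hp q hq => ⟨by rw [chi_mul, chi_of_mem_fixing ha.r_pos hp, hq.1, add_zero],
    hτ.pinned_fixing_mul hp hq.2⟩
  mem := hB
  bounded := hbd
  letters := hlet

theorem isAdapted_insert (ha : IsExpanding a r) (hτ : IsSpecialSeq a r τ) (S : Set ℕ) :
    IsAdapted chi a (pinnedKer τ S) (fixing n r) (insert a (pinnedKer τ S)) := by
  refine hτ.isAdapted ha (mem_insert _ _) ⟨1, fun b hb => ⟨[b], ?_, by simp, by simp⟩⟩ ?_
  · intro x hx
    obtain rfl := List.mem_singleton.1 hx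
    exact Or.inl (mem_insert_of_mem _ hb)
  · rintro x (rfl | hx)
    · right
      rw [ha.chi_eq]
      simp [one_mem]
    · exact Or.inl hx

end IsSpecialSeq

-- Existence of an expanding element, of special sequences and of infinite sparse sets.

theorem exists_isExpanding (n : ℕ) [n.AtLeastTwo] :
    ∃ (a : ThompsonF n) (r : I), IsExpanding a r := by
  have hn := two_le_cast n
  have hn0 : (0 : ℝ) < n := by linarith
  have hε : (0 : ℝ) < 1 / (n : ℝ) ^ 2 := by positivity
  have hlt : (n + 1) * (1 / (n : ℝ) ^ 2) < 1 := by
    rw [mul_one_div, div_lt_one (by positivity)]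
    nlinarith
  obtain ⟨a, h1, h2, h3, h4⟩ := exists_bump (n := n) (u := 0) (ε := 1 / (n : ℝ) ^ 2)
    ⟨0, 0, by simp⟩ ⟨1, 2, by simp⟩ le_rfl hε (by linarith)
  rw [zero_add] at h2 h3 h4
  have hle : 1 / (n : ℝ) ^ 2 ≤ (n + 1) * (1 / (n : ℝ) ^ 2) := by nlinarith
  refine ⟨a, ⟨(n + 1) * (1 / (n : ℝ) ^ 2), by positivity, hlt.le⟩, GermAt.chi_eq ?_, ?_, hlt⟩
  · refine ⟨⟨1 / (n : ℝ) ^ 2, hε.le, by linarith⟩, hε, fun z hz => ?_⟩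
    rw [h4 z z.2.1 hz, zpow_one]; ring
  · ext x
    simp only [mem_ofPred_eq, mem_Ioo]
    constructor
    · intro hx
      constructor
      · by_contra! h
        exact hx (h1 x h)
      · by_contra! h
        exact hx (h2 x h)
    · rintro ⟨hx0, hx1⟩
      exact (h3 x hx0 hx1).ne'

theorem exists_isSpecialSeq {a : ThompsonF n} {r : I} (ha : IsExpanding a r) :
    ∃ τ, IsSpecialSeq a r τ := by
  obtain ⟨t, ht0, htr⟩ := exists_between ha.r_pos
  have hlt : act t a⁻¹ < t := act_inv_lt.2 (ha.lt_act ht0 htr)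
  have hlt' : (act t a⁻¹ : ℝ) < t := hlt
  -- The indices from 2^k to 2^(k+1) - 1 are spread affinely over the fundamental domain from t down
  -- to t.a⁻¹, according to j/2^k ∈ [1, 2), and then moved by a^(-k).
  let w : ℕ → ℝ := fun j => (j : ℝ) / 2 ^ Nat.log 2 j
  have hw1 : ∀ j, 1 ≤ j → 1 ≤ w j := fun j hj => by
    rw [le_div_iff₀ (by positivity), one_mul]
    exact_mod_cast Nat.pow_log_le_self 2 (by omega)
  have hw2 : ∀ j, w j < 2 := fun j => by
    rw [div_lt_iff₀ (by positivity), mul_comm, ← pow_succ]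
    exact_mod_cast Nat.lt_pow_succ_log_self one_lt_two j
  let h : ℝ → ℝ := fun x => t + (x - 1) * (act t a⁻¹ - t)
  have hmem : ∀ x, 1 ≤ x → x ≤ 2 → h x ∈ Icc (0 : ℝ) 1 := fun x h1 h2 => by
    have := (act t a⁻¹).2.1
    have := t.2.2
    constructor <;> simp only [h] <;> nlinarith
  have hpos : ∀ x, x ≤ 2 → 0 < h x := fun x h2 => by
    have : (0 : ℝ) < act t a⁻¹ := act_pos ht0 a⁻¹
    simp only [h]; nlinarith
  let τ : ℕ → I := fun j => if hj : 1 ≤ j then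
    act ⟨h (w j), hmem _ (hw1 j hj) (hw2 j).le⟩ (a ^ Nat.log 2 j)⁻¹ else r
  have hτ : ∀ j (hj : 1 ≤ j), τ j = act ⟨h (w j), hmem _ (hw1 j hj) (hw2 j).le⟩
      (a ^ Nat.log 2 j)⁻¹ := fun j hj => dif_pos hj
  have hτ0 : τ 0 = r := dif_neg (by omega)
  have hτ1 : τ 1 = t := by
    rw [hτ 1 le_rfl, Nat.log_one_right, pow_zero, inv_one, act_one]
    ext
    simp [h, w]
  refine ⟨τ, hτ0, fun j => ?_, strictAnti_nat_of_succ_lt fun j => ?_, fun j hj => ?_⟩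
  · rcases Nat.eq_zero_or_pos j with rfl | hj
    · rw [hτ0]; exact ha.r_pos
    · rw [hτ j hj]
      exact act_pos (hpos _ (hw2 j).le) _
  · rcases Nat.eq_zero_or_pos j with rfl | hj
    · rw [hτ0, zero_add, hτ1]; exact htr
    rw [hτ j hj, hτ (j + 1) (by omega)]
    have hp1 := Nat.pow_log_le_self 2 (show j ≠ 0 by omega)
    have hp2 := Nat.lt_pow_succ_log_self one_lt_two j
    rcases Nat.lt_or_ge (j + 1) (2 ^ (Nat.log 2 j + 1)) with hl | hl
    · have e : Nat.log 2 (j + 1) = Nat.log 2 j :=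
        Nat.log_eq_of_pow_le_of_lt_pow (by omega) hl
      rw [e, act_lt_act, ← Subtype.coe_lt_coe]
      have : w j < w (j + 1) := by
        simp only [w, e]
        exact div_lt_div_of_pos_right (by push_cast; linarith) (by positivity)
      simp only [h]; nlinarith
    · have e0 : j + 1 = 2 ^ (Nat.log 2 j + 1) := by omega
      have e : Nat.log 2 (j + 1) = Nat.log 2 j + 1 := by
        rw [e0, Nat.log_pow one_lt_two]
      have e1 : w (j + 1) = 1 := by
        simp only [w]
        rw [e, e0]
        push_cast
        exact div_self (by positivity)
      have e2 : (⟨h (w (j + 1)), hmem _ (hw1 _ (by omega)) (hw2 _).le⟩ : I) = t := by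
        ext
        simp [h, e1]
      rw [e2, e, pow_succ, mul_inv_rev, act_mul, act_lt_act, ← Subtype.coe_lt_coe]
      have := hw2 j
      simp only [h]; nlinarith
  · rw [hτ j hj, hτ (2 * j) (by omega)]
    have e : Nat.log 2 (2 * j) = Nat.log 2 j + 1 := by
      rw [mul_comm]; exact Nat.log_mul_base one_lt_two (by omega)
    have e1 : w (2 * j) = w j := by
      simp only [w, e]
      push_cast
      rw [pow_succ]
      field_simp
    rw [← act_mul, ← mul_inv_rev, ← pow_succ', e]
    congr 2
    rw [e1]

/-- Since 3x = 4^a - 1 and 3 divides no power of 2, 4^a differs from 3·2^P y by at least 2^P when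
4^a > 2^P. If 4^a ≤ 2^P, then x is below a third of 2^P y. -/
theorem not_near_scaled {x y a P : ℕ} (hx : 3 * x + 1 = 4 ^ a) (hy : 1 ≤ y) (hP : 1 ≤ P) :
    (2 : ℤ) ^ P < |8 * (x : ℤ) - 8 * (2 ^ P * (y : ℤ))| := by
  have hx' : (3 : ℤ) * x + 1 = 4 ^ a := by exact_mod_cast hx
  have hy' : (1 : ℤ) ≤ y := by exact_mod_cast hy
  have hP0 : (2 : ℤ) ≤ 2 ^ P := by
    calc (2 : ℤ) = 2 ^ 1 := by norm_num
      _ ≤ 2 ^ P := pow_le_pow_right₀ (by norm_num) hP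
  have h4 : (4 : ℤ) ^ a = 2 ^ (2 * a) := by rw [pow_mul]; norm_num
  rw [lt_abs]
  rcases le_or_gt (2 * a) P with h | h
  · right
    have : (2 : ℤ) ^ (2 * a) ≤ 2 ^ P := pow_le_pow_right₀ (by norm_num) h
    nlinarith
  · obtain ⟨d, hd⟩ : ∃ d, 2 * a = P + d := ⟨2 * a - P, by omega⟩
    rw [hd, pow_add] at h4
    have hne : (2 : ℤ) ^ d - 3 * y ≠ 0 := by
      intro h0
      have h3 : (3 : ℤ) ∣ 2 ^ d := ⟨y, by linarith⟩
      have h3' : 3 ∣ 2 ^ d := by exact_mod_cast h3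
      exact absurd (Nat.prime_three.dvd_of_dvd_pow h3') (by norm_num)
    rcases lt_or_gt_of_ne hne with h0 | h0
    · right
      have : (2 : ℤ) ^ d - 3 * y ≤ -1 := by omega
      nlinarith
    · left
      have : 1 ≤ (2 : ℤ) ^ d - 3 * y := by omega
      nlinarith

theorem exists_infinite_isSparse : ∃ O : Set ℕ, O.Infinite ∧ IsSparse O := by
  -- The numbers 1, 5, 21, 85, … = (4^(k+1) - 1)/3. For negative `p` sparseness reduces to parity:
  -- an even multiple of one of them is never another.
  let f : ℕ → ℕ := fun k => ∑ i ∈ Finset.range (k + 1), 4 ^ i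
  have hf : ∀ k, 3 * f k + 1 = 4 ^ (k + 1) := by
    intro k
    induction k with
    | zero => simp [f]
    | succ k ih =>
      have : f (k + 1) = f k + 4 ^ (k + 1) := Finset.sum_range_succ _ _
      rw [this, pow_succ 4 (k + 1)]; omega
  have hodd : ∀ k, Odd (f k) := fun k => by
    have := hf k
    rw [pow_succ] at this
    rw [Nat.odd_iff]; omega
  refine ⟨range f, Set.infinite_range_of_injective fun i j hij => ?_, ?_, ?_⟩
  · have h1 := hf i
    rw [hij, hf j] at h1
    have := Nat.pow_right_injective (le_refl 2 |>.trans (by norm_num : 2 ≤ 4)) h1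
    omega
  · rintro _ ⟨k, rfl⟩
    exact hodd k
  · rintro _ ⟨i, rfl⟩ _ ⟨j, rfl⟩ p hp
    have e3 : (2 : ℝ) ^ (p - 3) = 2 ^ p / 8 := by
      rw [zpow_sub₀ two_ne_zero]; norm_num
    rw [e3] at hp
    obtain ⟨P, rfl | rfl⟩ := p.eq_nat_or_neg
    · rcases Nat.eq_zero_or_pos P with rfl | hP
      · refine ⟨rfl, ?_⟩
        rw [Nat.cast_zero, zpow_zero, one_mul] at hp
        have h1 : |((f i : ℤ) - f j : ℤ)| < 1 := by
          have : ((|((f i : ℤ) - f j : ℤ)| : ℤ) : ℝ) < 1 := by push_cast; linarith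
          exact_mod_cast this
        rw [Int.abs_lt_one_iff] at h1
        omega
      · exfalso
        have h1 := not_near_scaled (hf i) (hodd j).pos hP
        have h2 : ((2 ^ P : ℤ) : ℝ) < ((|8 * (f i : ℤ) - 8 * (2 ^ P * (f j : ℤ))| : ℤ) : ℝ) := by
          exact_mod_cast h1
        push_cast at h2
        rw [zpow_natCast] at hp
        rw [← mul_sub, abs_mul, abs_of_pos (by norm_num : (0 : ℝ) < 8)] at h2
        linarith
    · rcases Nat.eq_zero_or_pos P with rfl | hP
      · simp at hp ⊢
        have h1 : |((f i : ℤ) - f j : ℤ)| < 1 := by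
          have : ((|((f i : ℤ) - f j : ℤ)| : ℤ) : ℝ) < 1 := by push_cast; linarith
          exact_mod_cast this
        rw [Int.abs_lt_one_iff] at h1
        omega
      exfalso
      have hp0 : (0 : ℝ) < 2 ^ P := by positivity
      rw [zpow_neg, zpow_natCast] at hp
      have h2 : |(2 : ℝ) ^ P * f i - f j| ≤ 1 / 8 := by
        have e : (2 : ℝ) ^ P * f i - f j = 2 ^ P * (f i - (2 ^ P)⁻¹ * f j) := by field_simp
        rw [e, abs_mul, abs_of_pos hp0]
        refine (mul_le_mul_of_nonneg_left hp hp0.le).trans (le_of_eq ?_)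
        field_simp
      have h1 : |((2 ^ P * f i : ℤ) - f j : ℤ)| < 1 := by
        have : ((|((2 ^ P * f i : ℤ) - f j : ℤ)| : ℤ) : ℝ) < 1 := by push_cast; linarith
        exact_mod_cast this
      rw [Int.abs_lt_one_iff] at h1
      have h3 : 2 ^ P * f i = f j := by
        have : (2 ^ P * f i : ℤ) = f j := by omega
        exact_mod_cast this
      have h4 := hodd j
      rw [← h3, Nat.odd_mul] at h4
      exact absurd h4.1 (by simp [Nat.odd_pow_iff (show P ≠ 0 by omega)])

end Thompson

-- Domination between adapted alphabets.

section Adapted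

variable {G : Type*} [Group G] {χ : G → ℤ} {a : G}

theorem BoundedIn.of_subset {A B C : Set G} (h : B ⊆ C) (hC : BoundedIn A C) : BoundedIn A B := by
  obtain ⟨K, hK⟩ := hC
  exact ⟨K, fun b hb => hK b (h hb)⟩

theorem BoundedIn.union {A B C : Set G} (hB : BoundedIn A B) (hC : BoundedIn A C) :
    BoundedIn A (B ∪ C) := by
  obtain ⟨K, hK⟩ := hB
  obtain ⟨L, hL⟩ := hC
  refine ⟨max K L, ?_⟩
  rintro b (hb | hb)
  · obtain ⟨l, h1, h2, h3⟩ := hK b hb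
    exact ⟨l, h1, h2.trans (le_max_left _ _), h3⟩
  · obtain ⟨l, h1, h2, h3⟩ := hL b hb
    exact ⟨l, h1, h2.trans (le_max_right _ _), h3⟩

theorem BoundedIn.of_subset_left {A B : Set G} (h : B ⊆ A) : BoundedIn A B :=
  (BoundedIn.refl A).of_subset h

namespace IsAdapted

theorem boundedIn {Q Q' : Set G} {P P' : Subgroup G} {B B' : Set G}
    (hB : IsAdapted χ a Q P B) (hQ' : IsContracting χ a Q') (hB' : IsAdapted χ a Q' P' B')
    (h : Q' ⊆ Q) : BoundedIn B B' := by
  obtain ⟨K, hK⟩ := hB.bounded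
  refine ⟨K + 1, fun x hx => ?_⟩
  rcases hB'.letters x hx with hxQ | ⟨h1, h2⟩
  · obtain ⟨l, hl, hlen, hp⟩ := hK x (h hxQ)
    exact ⟨l, hl, by omega, hp⟩
  · have hp := hB'.absorb _ h2 _ hQ'.one_mem
    rw [mul_one] at hp
    obtain ⟨l, hl, hlen, hlp⟩ := hK _ (h hp)
    obtain ⟨w, hw, hwlen, hwp⟩ : ∃ w, IsWord B w ∧ w.length ≤ 1 ∧ w.prod = a ^ χ x := by
      rw [abs_le] at h1
      obtain h0 | h0 | h0 : χ x = 0 ∨ χ x = 1 ∨ χ x = -1 := by omega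
      · exact ⟨[], by simp [IsWord], by simp, by simp [h0]⟩
      · exact ⟨[a], by simp [IsWord, hB.mem], by simp, by simp [h0]⟩
      · exact ⟨[a⁻¹], by simp [IsWord, hB.mem], by simp, by simp [h0]⟩
    refine ⟨w ++ l, hw.append hl, by simp; omega, ?_⟩
    rw [List.prod_append, hwp, hlp]
    group

/-- The hyperbolic generating set given by an adapted alphabet. -/
def hypGenSet {Q : Set G} {P : Subgroup G} {B : Set G} (hB : IsAdapted χ a Q P B)
    (hQ : IsContracting χ a Q) : HypGenSet G :=
  ⟨⟨B, hB.closure_eq_top hQ⟩, isGromovHyperbolic hQ ⟨B, hB.closure_eq_top hQ⟩ hB⟩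

end IsAdapted

end Adapted

-- Hyperbolic structures on F_n, splittings and lamplike sets.

section Thompson

local notation "I" => unitInterval

variable {n : ℕ} [n.AtLeastTwo]

namespace IsSpecialSeq

variable {a : ThompsonF n} {r : I} {τ : ℕ → I}

/-- The hyperbolic structure given by an adapted alphabet. -/
def hyp (ha : IsExpanding a r) (hτ : IsSpecialSeq a r τ) {S : Set ℕ} (hS : ∀ s ∈ S, Odd s)
    {B : Set (ThompsonF n)} (hB : IsAdapted chi a (pinnedKer τ S) (fixing n r) B) :
    Hyp (ThompsonF n) :=
  toAntisymmetrization (· ≤ ·) (hB.hypGenSet (hτ.isContracting ha hS))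

theorem hyp_isClassOf (ha : IsExpanding a r) (hτ : IsSpecialSeq a r τ) {S : Set ℕ}
    (hS : ∀ s ∈ S, Odd s) {B : Set (ThompsonF n)}
    (hB : IsAdapted chi a (pinnedKer τ S) (fixing n r) B) : (hτ.hyp ha hS hB).IsClassOf B :=
  ⟨_, rfl, rfl⟩

theorem hyp_mem (ha : IsExpanding a r) (hτ : IsSpecialSeq a r τ) {S : Set ℕ}
    (hS : ∀ s ∈ S, Odd s) (hne : S.Nonempty) {B : Set (ThompsonF n)}
    (hB : IsAdapted chi a (pinnedKer τ S) (fixing n r) B) : hτ.hyp ha hS hB ∈ PosetX n := by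
  refine ⟨_, rfl, ?_⟩
  have e : (chi0 : ThompsonF n → ℝ) = fun g => (chi g : ℝ) := funext chi0_eq
  rw [e]
  obtain ⟨g, hg, hpin, hnot⟩ := hτ.exists_not_pinned ha hS hne
  exact IsAdapted.isQuasiParabolicWith (hτ.isContracting ha hS) _ hB
    ⟨g, ⟨chi_of_mem_commutator hg, hpin⟩, fun h => hnot h.2⟩

/-- Domination puts a conjugate by some a^N of the pinned elements for R into those for S, which
sparseness allows only if S ⊆ R; the converse is inclusion of the contracting sets. -/
theorem boundedIn_iff (ha : IsExpanding a r) (hτ : IsSpecialSeq a r τ) {O S R : Set ℕ}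
    (hO : IsSparse O) (hS : S ⊆ O) (hR : R ⊆ O) {B C : Set (ThompsonF n)}
    (hB : IsAdapted chi a (pinnedKer τ S) (fixing n r) B)
    (hC : IsAdapted chi a (pinnedKer τ R) (fixing n r) C) : BoundedIn B C ↔ S ⊆ R := by
  have hQS := hτ.isContracting ha (S := S) fun s hs => hO.1 s (hS hs)
  have hQR := hτ.isContracting ha (S := R) fun s hs => hO.1 s (hR hs)
  constructor
  · intro h
    obtain ⟨K, hK⟩ := h.trans hC.bounded
    obtain ⟨N, hN⟩ := IsAdapted.conj_mem_of_word hQS hB K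
    refine hτ.subset_of_conj_pinned ha hO hS hR (N := N) fun g hg hpin => ?_
    obtain ⟨l, hl, hlen, rfl⟩ := hK g ⟨chi_of_mem_commutator hg, hpin⟩
    exact (hN l hl hlen (chi_of_mem_commutator hg)).2
  · intro h
    exact hB.boundedIn hQR hC fun g hg => ⟨hg.1, hg.2.mono h⟩

theorem exists_embedding (ha : IsExpanding a r) (hτ : IsSpecialSeq a r τ) {O : Set ℕ}
    (hO : IsSparse O) (hinf : O.Infinite) (B : Set ℕ → Set (ThompsonF n))
    (hB : ∀ S, IsAdapted chi a (pinnedKer τ S) (fixing n r) (B S)) :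
    ∃ Φ : Set ℕ ↪o PosetX n, ∀ T : Set ℕ, ∃ S ⊆ O, S.Nonempty ∧
      (Φ T : Hyp (ThompsonF n)).IsClassOf (B S) := by
  let o : ℕ → ℕ := fun k => (hinf.natEmbedding O k : ℕ)
  have ho : ∀ k, o k ∈ O := fun k => (hinf.natEmbedding O k).2
  have hinj : Function.Injective o :=
    Subtype.val_injective.comp (hinf.natEmbedding O).injective
  -- The element `o 0` is always present, because the empty set would not give a quasi-parabolic
  -- structure by `hyp_mem`; the shift leaves the remaining elements free to encode T.
  let c : Set ℕ → Set ℕ := fun T => insert (o 0) ((fun k => o (k + 1)) '' T)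
  have hc : ∀ T, c T ⊆ O := by
    rintro T _ (rfl | ⟨k, -, rfl⟩)
    exacts [ho _, ho _]
  have hcne : ∀ T, (c T).Nonempty := fun T => insert_nonempty _ _
  have hcle : ∀ T U, c T ⊆ c U ↔ T ⊆ U := by
    intro T U
    refine ⟨fun h k hk => ?_, fun h => insert_subset_insert (image_mono h)⟩
    rcases h (Or.inr ⟨k, hk, rfl⟩) with h | ⟨k', hk', h⟩
    · exact absurd (hinj h) (by omega)
    · have := hinj h
      obtain rfl : k' = k := by omega
      exact hk'
  have hodd : ∀ T, ∀ s ∈ c T, Odd s := fun T s hs => hO.1 s (hc T hs)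
  refine ⟨OrderEmbedding.ofMapLEIff
    (fun T => ⟨hτ.hyp ha (hodd T) (hB (c T)), hτ.hyp_mem ha (hodd T) (hcne T) (hB (c T))⟩) ?_,
    fun T => ⟨c T, hc T, hcne T, hτ.hyp_isClassOf ha (hodd T) (hB (c T))⟩⟩
  intro T U
  exact (hτ.boundedIn_iff ha hO (hc T) (hc U) (hB (c T)) (hB (c U))).trans (hcle T U)

end IsSpecialSeq

namespace Splitting

variable (σ : Splitting n)

theorem isExpanding : IsExpanding (σ.a 0) (σ.r 0) where
  chi_eq := by
    have := σ.chi0_zero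
    rw [chi0_eq] at this
    exact_mod_cast this
  support := by rw [σ.support 0, σ.l_zero]
  lt_one := by
    have h2 : 2 ≤ n := Nat.AtLeastTwo.prop
    have := σ.separated 0 ⟨1, h2⟩ (by simp)
    exact (this.trans (σ.lt _)).trans_le le_top

variable {σ} in
theorem IsSpecial.isSpecialSeq {τ : ℕ → I} (hτ : σ.IsSpecial τ) :
    IsSpecialSeq (σ.a 0) (σ.r 0) τ := ⟨hτ.zero, hτ.pos, hτ.anti, hτ.double⟩

theorem r_lt_l (i : ℕ) (hi : i + 1 < n) : σ.r 0 < σ.l ⟨i + 1, hi⟩ := by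
  induction i with
  | zero => exact σ.separated 0 ⟨1, hi⟩ (by simp)
  | succ i ih =>
    exact ((ih (by omega)).trans (σ.lt _)).trans (σ.separated ⟨i + 1, by omega⟩ ⟨i + 2, hi⟩ rfl)

theorem a_mem_fixing {i : Fin n} (hi : i ≠ 0) : σ.a i ∈ fixing n (σ.r 0) := by
  intro x hx
  by_contra h
  have hx' : x ∈ {x | act x (σ.a i) ≠ x} := h
  rw [σ.support] at hx'
  obtain ⟨j, hj⟩ : ∃ j, (i : ℕ) = j + 1 :=
    Nat.exists_eq_succ_of_ne_zero fun h => hi (Fin.ext (by simpa using h))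
  have h1 := σ.r_lt_l j (by omega)
  have h2 : (⟨j + 1, by omega⟩ : Fin n) = i := Fin.ext hj.symm
  rw [h2] at h1
  exact absurd (hx'.1.trans_le hx) (not_lt.2 h1.le)

theorem a_mem_Z (i : Fin n) : σ.a i ∈ σ.Z := Subgroup.subset_closure ⟨i, rfl⟩

/-- All generators other than a_0 are supported to the right of r, so on [0, r] an element of Z acts
as a power of a_0. -/
theorem mem_fixing_of_mem_Z {z : ThompsonF n} (hz : z ∈ σ.Z) :
    (σ.a 0) ^ (-chi z) * z ∈ fixing n (σ.r 0) := by
  have ha := σ.isExpanding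
  have hchi : ∀ k : ℤ, ∀ p ∈ fixing n (σ.r 0), chi (σ.a 0 ^ k * p) = k := fun k p hp => by
    rw [chi_mul, chi_zpow, ha.chi_eq, chi_of_mem_fixing ha.r_pos hp]; ring
  suffices h : ∃ k : ℤ, ∃ p ∈ fixing n (σ.r 0), z = σ.a 0 ^ k * p by
    obtain ⟨k, p, hp, rfl⟩ := h
    rw [hchi k p hp]
    simpa using hp
  have hcomm : ∀ k : ℤ, ∀ p ∈ fixing n (σ.r 0), σ.a 0 ^ k * p = p * σ.a 0 ^ k := fun k p hp =>
    ((show Commute (σ.a 0) p from ha.comm_fixing hp).zpow_left k).eq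
  refine Subgroup.closure_induction ?_ ?_ ?_ ?_ hz
  · rintro _ ⟨i, rfl⟩
    by_cases hi : i = 0
    · subst hi
      exact ⟨1, 1, one_mem _, by simp⟩
    · exact ⟨0, _, σ.a_mem_fixing hi, by simp⟩
  · exact ⟨0, 1, one_mem _, by simp⟩
  · rintro _ _ - - ⟨k, p, hp, rfl⟩ ⟨l, q, hq, rfl⟩
    refine ⟨k + l, p * q, mul_mem hp hq, ?_⟩
    rw [zpow_add, mul_assoc, ← mul_assoc p, ← hcomm l p hp]
    group
  · rintro _ - ⟨k, p, hp, rfl⟩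
    refine ⟨-k, p⁻¹, inv_mem hp, ?_⟩
    rw [hcomm _ _ (inv_mem hp), mul_inv_rev, zpow_neg]

theorem exists_eq_pow_mul {z : ThompsonF n} (hz : z ∈ σ.Z) (h0 : 0 ≤ chi z) :
    ∃ k : ℕ, ∃ p ∈ fixing n (σ.r 0), z = σ.a 0 ^ k * p := by
  have h := σ.mem_fixing_of_mem_Z hz
  refine ⟨(chi z).toNat, _, h, ?_⟩
  rw [← zpow_natCast, Int.toNat_of_nonneg h0]
  group

variable {σ} {τ : ℕ → I}

theorem IsSpecial.strictlyConfining (hτ : σ.IsSpecial τ) {S : Set ℕ} (hS : ∀ s ∈ S, Odd s)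
    (hne : S.Nonempty) : σ.StrictlyConfining (QS τ S) := by
  have ha := σ.isExpanding
  have hτ' := hτ.isSpecialSeq
  have hconj : ∀ q ∈ commutator (ThompsonF n), ∀ z, z⁻¹ * q * z ∈ commutator (ThompsonF n) :=
    fun q hq z => by
      have := (inferInstance : (commutator (ThompsonF n)).Normal).conj_mem q hq z⁻¹
      simpa using this
  have hstay : ∀ z ∈ σ.Z, 0 ≤ chi0 z → ∀ q ∈ QS τ S, z⁻¹ * q * z ∈ QS τ S := by
    intro z hz h0 q hq
    rw [chi0_eq] at h0
    obtain ⟨k, p, hp, rfl⟩ := σ.exists_eq_pow_mul hz (by exact_mod_cast h0)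
    exact ⟨hconj q hq.1 _, hτ'.pinned_stay ha hS hp hq.2⟩
  refine ⟨⟨fun q hq => hq.1, fun q hq => ⟨inv_mem hq.1, Pinned.inv hq.2⟩, hstay, ?_, ?_⟩, ?_⟩
  · intro h hh
    obtain ⟨k, hk⟩ := hτ'.pinned_get ha hS (chi_of_mem_commutator hh)
    exact ⟨σ.a 0 ^ k, pow_mem (σ.a_mem_Z 0) k, hconj h hh _, hk⟩
  · exact ⟨σ.a 0 ^ 5, pow_mem (σ.a_mem_Z 0) 5, fun p hp q hq =>
      ⟨hconj _ (mul_mem hp.1 hq.1) _, hτ'.pinned_mul ha hS hp.2 hq.2⟩⟩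
  · refine ⟨σ.a 0, σ.a_mem_Z 0, ?_⟩
    obtain ⟨g, hg, hpin, hnot⟩ := hτ'.exists_not_pinned ha hS hne
    rw [ssubset_iff_of_subset]
    · refine ⟨g, ⟨hg, hpin⟩, ?_⟩
      rintro ⟨q, hq, rfl⟩
      refine hnot ?_
      have : σ.a 0 * ((σ.a 0)⁻¹ * q * σ.a 0) * (σ.a 0)⁻¹ = q := by group
      rw [this]
      exact hq.2
    · rintro _ ⟨q, hq, rfl⟩
      exact hstay _ (σ.a_mem_Z 0) (by rw [σ.chi0_zero]; exact zero_le_one) q hq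

theorem IsSpecial.isAdapted (hτ : σ.IsSpecial τ) (S : Set ℕ) :
    IsAdapted chi (σ.a 0) (pinnedKer τ S) (fixing n (σ.r 0)) (σ.alphabet (QS τ S)) := by
  have ha := σ.isExpanding
  have hτ' := hτ.isSpecialSeq
  have haZ : σ.a 0 ∈ σ.alphabet (QS τ S) :=
    Or.inr ⟨σ.a_mem_Z 0, by rw [σ.chi0_zero, abs_one]⟩
  refine hτ'.isAdapted ha haZ ⟨2, fun g hg => ?_⟩ ?_
  · have hmem : g ∈ commutator (ThompsonF n) ⊔ Subgroup.closure (range σ.a) := by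
      rw [σ.generates]; exact Subgroup.mem_top g
    rw [Subgroup.mem_sup_of_normal_left] at hmem
    obtain ⟨f, hf, z, hz, rfl⟩ := hmem
    have hchi : chi z = 0 := by
      have := hg.1
      rw [chi_mul, chi_of_mem_commutator hf, zero_add] at this
      exact this
    have hzfix : z ∈ fixing n (σ.r 0) := by
      have := σ.mem_fixing_of_mem_Z hz
      rwa [hchi, neg_zero, zpow_zero, one_mul] at this
    have hfpin : Pinned τ S f := by
      have := (hτ'.pinned_fixing_mul hzfix hg.2.inv).inv
      simpa using this
    refine ⟨[f, z], ?_, by simp, by simp⟩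
    intro x hx
    simp only [List.mem_cons, List.not_mem_nil, or_false] at hx
    rcases hx with rfl | rfl
    · exact Or.inl (Or.inl ⟨hf, hfpin⟩)
    · exact Or.inl (Or.inr ⟨hz, by rw [chi0_eq, hchi]; simp⟩)
  · rintro x (hx | ⟨hx, hx1⟩)
    · exact Or.inl ⟨chi_of_mem_commutator hx.1, hx.2⟩
    · refine Or.inr ⟨?_, σ.mem_fixing_of_mem_Z hx⟩
      rw [chi0_eq] at hx1
      exact_mod_cast hx1

theorem confLE_iff_boundedIn {Q Q' : Set (ThompsonF n)} :
    σ.ConfLE Q Q' ↔ BoundedIn (σ.alphabet Q) (σ.alphabet Q') :=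
  ⟨fun h => BoundedIn.union h (BoundedIn.of_subset_left subset_union_right),
    fun h => h.of_subset subset_union_left⟩

theorem IsSpecial.confLE_iff (hτ : σ.IsSpecial τ) {O S R : Set ℕ} (hO : IsSparse O) (hS : S ⊆ O)
    (hR : R ⊆ O) : σ.ConfLE (QS τ S) (QS τ R) ↔ S ⊆ R :=
  confLE_iff_boundedIn.trans
    (hτ.isSpecialSeq.boundedIn_iff σ.isExpanding hO hS hR (hτ.isAdapted S) (hτ.isAdapted R))

variable (σ)

/-- Short words over a confining subset that fixes `t` move the translates `t.a⁻ʲ` as powers of `a`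
do. -/
theorem act_word {Q : Set (ThompsonF n)} {t : I} (ht : t ∈ Ioo 0 (σ.r 0)) (hQ : σ.FixesPoint Q t)
    (w : List (ThompsonF n)) (hw : IsWord (σ.alphabet Q) w) (j : ℤ) (hj : (w.length : ℤ) ≤ j) :
    act (act t (σ.a 0 ^ (-j))) w.prod = act t (σ.a 0 ^ (chi w.prod - j)) := by
  have ha := σ.isExpanding
  induction w generalizing j with
  | nil => simp [chi_one]
  | cons x w ih =>
    have ih' := ih fun y hy => hw y (List.mem_cons_of_mem _ hy)
    simp only [List.length_cons, Nat.cast_add, Nat.cast_one] at hj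
    rw [List.prod_cons, chi_mul, act_mul]
    have hQinv : x ∈ Q ∨ (x ∈ σ.Z ∧ |chi x| ≤ 1) := by
      have habs : ∀ y : ThompsonF n, |chi0 y| ≤ 1 → |chi y| ≤ 1 := fun y hy => by
        rw [chi0_eq] at hy
        exact_mod_cast hy
      rcases hw x List.mem_cons_self with (h | h) | (h | h)
      · exact Or.inl h
      · exact Or.inr ⟨h.1, habs _ h.2⟩
      · left; simpa using hQ.1.symmetric _ h
      · refine Or.inr ⟨by simpa using inv_mem h.1, ?_⟩
        have := habs _ h.2
        rwa [chi_inv, abs_neg] at this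
    rcases hQinv with hx | ⟨hx, hx1⟩
    · have h0 := chi_of_mem_commutator (hQ.1.subset hx)
      have hfix : act (act t (σ.a 0 ^ (-j))) x = act t (σ.a 0 ^ (-j)) := by
        -- Q contains its conjugates by nonnegative powers of a, so its elements fix t.a^(-j) for
        -- all j ≥ 0. A letter of Z lowers j by at most one, which is why j must be at least the
        -- length of the word.
        have h1 := hQ.2 _ (hQ.1.stay (σ.a 0 ^ j) (zpow_mem (σ.a_mem_Z 0) j) (by
          rw [chi0_eq, chi_zpow, ha.chi_eq, mul_one]
          have : 0 ≤ j := by omega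
          exact_mod_cast this) x hx)
        rw [act_mul, act_mul] at h1
        rw [zpow_neg]
        rw [← act_inj (g := σ.a 0 ^ j), h1, act_inv_act]
      rw [hfix, ih' j (by omega), h0, zero_add]
    · have hp := σ.mem_fixing_of_mem_Z hx
      have hle : ∀ k : ℤ, act t (σ.a 0 ^ k) ≤ σ.r 0 := fun k => by
        rw [← act_iterate_const (ha.act_of_ge (x := σ.r 0) le_rfl) k]
        exact act_le_act.2 ht.2.le
      have e : x = σ.a 0 ^ chi x * (σ.a 0 ^ (-chi x) * x) := by group
      have hstep : act (act t (σ.a 0 ^ (-j))) x = act t (σ.a 0 ^ (-(j - chi x))) := by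
        conv_lhs => rw [e]
        rw [act_mul, ← act_mul t, ← zpow_add, hp _ (hle _)]
        congr 2; ring
      rw [abs_le] at hx1
      rw [hstep, ih' _ (by omega)]
      congr 2; ring

theorem exists_common_fixed {Q : Set (ThompsonF n)} {t : I} (ht : t ∈ Ioo 0 (σ.r 0))
    (hQ : σ.FixesPoint Q t) {C : Set (ThompsonF n)} (hC : BoundedIn (σ.alphabet Q) C)
    (hker : ∀ g ∈ C, chi g = 0) : ∃ u : I, 0 < u ∧ u < 1 ∧ ∀ g ∈ C, act u g = u := by
  have ha := σ.isExpanding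
  obtain ⟨K, hK⟩ := hC
  refine ⟨act t (σ.a 0 ^ (-K : ℤ)), act_pos ht.1 _, ?_, fun g hg => ?_⟩
  · rw [← act_top (σ.a 0 ^ (-K : ℤ)), act_lt_act]
    exact ht.2.trans ha.lt_one
  · obtain ⟨w, hw, hlen, rfl⟩ := hK g hg
    rw [σ.act_word ht hQ w hw K (by exact_mod_cast hlen), hker _ hg, zero_sub]

end Splitting

namespace IsSpecialSeq

variable {a : ThompsonF n} {r : I} {τ : ℕ → I}

theorem no_common_fixed (ha : IsExpanding a r) (hτ : IsSpecialSeq a r τ) {S : Set ℕ}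
    (hS : ∀ s ∈ S, Odd s) :
    ¬ ∃ u : I, 0 < u ∧ u < 1 ∧ ∀ g ∈ (QS τ S : Set (ThompsonF n)), act u g = u := by
  rintro ⟨u, h0, h1, h⟩
  obtain ⟨g, hg, hpin, hmove⟩ := hτ.exists_pinned_moving ha hS h0 h1
  exact hmove (h g ⟨hg, hpin⟩)

theorem not_boundedIn_fixesPoint (ha : IsExpanding a r) (hτ : IsSpecialSeq a r τ) {S : Set ℕ}
    (hS : ∀ s ∈ S, Odd s) (σ : Splitting n) {Q : Set (ThompsonF n)} {t : I}
    (ht : t ∈ Ioo 0 (σ.r 0)) (hQ : σ.FixesPoint Q t) :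
    ¬ BoundedIn (σ.alphabet Q) (QS τ S : Set (ThompsonF n)) := fun h =>
  hτ.no_common_fixed ha hS
    (σ.exists_common_fixed ht hQ h fun _ hg => chi_of_mem_commutator hg.1)

/-- The `a` and `r` of the sequence need not come from `σ`: Q_S lies in ker χ and has no common
fixed point in (0, 1), and this contradicts lamplikeness with respect to any splitting. -/
theorem not_lamplikeStructure (ha : IsExpanding a r) (hτ : IsSpecialSeq a r τ) {S : Set ℕ}
    (hS : ∀ s ∈ S, Odd s) {B : Set (ThompsonF n)}
    (hB : IsAdapted chi a (pinnedKer τ S) (fixing n r) B) {s : Hyp (ThompsonF n)}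
    (hs : s.IsClassOf B) (σ : Splitting n) : ¬ σ.LamplikeStructure s := by
  rintro ⟨Q, -, ⟨t, ht, Q', hQ', -, hle⟩, D, hD, hDs⟩
  obtain ⟨E, hE, hEs⟩ := hs
  have h1 : BoundedIn (σ.alphabet Q') (σ.alphabet Q) := Splitting.confLE_iff_boundedIn.1 hle
  have h2 : D ≤ E := by
    have : toAntisymmetrization (· ≤ ·) D = toAntisymmetrization (· ≤ ·) E := hDs.trans hEs.symm
    exact (Quotient.exact this).1
  have h3 : BoundedIn (σ.alphabet Q) B := by
    rw [← hD, ← hE]; exact h2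
  have h4 : BoundedIn (σ.alphabet Q') (pinnedKer τ S) := (h1.trans h3).trans hB.bounded
  exact hτ.not_boundedIn_fixesPoint ha hS σ ht hQ'
    (h4.of_subset (show QS τ S ⊆ pinnedKer τ S from
      fun g hg => ⟨chi_of_mem_commutator hg.1, hg.2⟩))

end IsSpecialSeq

end Thompson

end ThompsonHyp

end

open ThompsonHyp
theorem theoremF (n : ℕ) [n.AtLeastTwo] :
    (∃ Φ : Set ℕ ↪o PosetX n, ∀ (T : Set ℕ) (σ : Splitting n), ¬ σ.LamplikeStructure (Φ T)) ∧
    (∃ O : Set ℕ, O.Infinite ∧ IsSparse O) ∧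
    ∀ σ : Splitting n,
      (∃ τ : ℕ → unitInterval, σ.IsSpecial τ) ∧
      ∀ τ : ℕ → unitInterval, σ.IsSpecial τ →
        (∀ S : Set ℕ, (∀ s ∈ S, Odd s) → S.Nonempty →
          σ.StrictlyConfining (QS τ S) ∧ ¬ σ.Lamplike (QS τ S) ∧
          ∃ s ∈ PosetX n, s.IsClassOf (σ.alphabet (QS τ S)) ∧ ¬ σ.LamplikeStructure s) ∧
        ∀ O : Set ℕ, IsSparse O →
          (∀ S R : Set ℕ, S ⊆ O → R ⊆ O → (σ.ConfLE (QS τ S) (QS τ R) ↔ S ⊆ R)) ∧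
          (O.Infinite → ∃ Φ : Set ℕ ↪o PosetX n, ∀ T : Set ℕ,
            ¬ σ.LamplikeStructure (Φ T) ∧
            ∃ S : Set ℕ, S ⊆ O ∧ S.Nonempty ∧
              (Φ T : Hyp (ThompsonF n)).IsClassOf (σ.alphabet (QS τ S))) := by
  obtain ⟨O, hinf, hO⟩ := exists_infinite_isSparse
  refine ⟨?_, ⟨O, hinf, hO⟩, fun σ => ⟨?_, fun τ hτ => ⟨fun S hS hne => ⟨?_, ?_, ?_⟩,
    fun O hO => ⟨fun S R hS hR => hτ.confLE_iff hO hS hR, fun hinf => ?_⟩⟩⟩⟩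
  · obtain ⟨a, r, ha⟩ := exists_isExpanding n
    obtain ⟨τ, hτ⟩ := exists_isSpecialSeq ha
    obtain ⟨Φ, hΦ⟩ := hτ.exists_embedding ha hO hinf _ (hτ.isAdapted_insert ha)
    refine ⟨Φ, fun T σ => ?_⟩
    obtain ⟨S, hS, -, hcls⟩ := hΦ T
    exact hτ.not_lamplikeStructure ha (fun s hs => hO.1 s (hS hs)) (hτ.isAdapted_insert ha S) hcls σ
  · obtain ⟨τ, hτ⟩ := exists_isSpecialSeq σ.isExpanding
    exact ⟨τ, hτ.zero, hτ.pos, hτ.anti, hτ.double⟩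
  · exact hτ.strictlyConfining hS hne
  · rintro ⟨t, ht, Q, hQ, -, hle⟩
    exact hτ.isSpecialSeq.not_boundedIn_fixesPoint σ.isExpanding hS σ ht hQ hle
  · have ha := σ.isExpanding
    have hτ' := hτ.isSpecialSeq
    have hcls := hτ'.hyp_isClassOf ha hS (hτ.isAdapted S)
    exact ⟨_, hτ'.hyp_mem ha hS hne (hτ.isAdapted S), hcls,
      hτ'.not_lamplikeStructure ha hS (hτ.isAdapted S) hcls σ⟩
  · have ha := σ.isExpanding
    have hτ' := hτ.isSpecialSeq
    obtain ⟨Φ, hΦ⟩ := hτ'.exists_embedding ha hO hinf _ hτ.isAdapted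
    refine ⟨Φ, fun T => ?_⟩
    obtain ⟨S, hS, hne, hcls⟩ := hΦ T
    exact ⟨hτ'.not_lamplikeStructure ha (fun s hs => hO.1 s (hS hs)) (hτ.isAdapted S) hcls σ,
      S, hS, hne, hcls⟩
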